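/- Let $H_0^2([0,1])$ be the Sobolev space of functions $f$ on $[0,1]$ with $f''\in L^2$ and $f=f'=0$ at $0$ and $1$, with norm $\|f''\|_{L^2}$. Let $$\mathrm{Diff}_0^2([0,1])=\{\varphi=\mathrm{Id}+f:\ f\in H_0^2([0,1]),\ 1+f'>0\},$$ an open subset of $\mathrm{Id}+H_0^2([0,1])$, carry the right-invariant metric $G_\varphi(X,Y)=\int_0^1 (X\circ\varphi^{-1})''\,(Y\circ\varphi^{-1})''\,dx$. For $q\in L^2([0,1])$ and $x\in[0,1]$ put $$\eta(q)(x)=\exp\Big(\int_0^x q\Big),\qquad \varphi(q)(x)=\int_0^x\eta(q)(y)\,dy .$$ Let $Q\subset L^2([0,1])$ be the submanifold $\int_0^1 q=0$, $\int_0^1\eta(q)=1$, with the metric $G(q)(X,Y)=\int_0^1 XY/\eta(q)\,dx$ on $T_qQ=\{X\in L^2:\int_0^1 X=\int_0^1 X\varphi(q)=0\}$. By means of this metric and the $L^2$ pairing, identify the cotangent bundle with $$T^*Q=\Big\{(q,p)\in Q\times L^2([0,1]):\ \int_0^1\eta(q)\,p\,dx=\int_0^1\eta(q)\,\varphi(q)\,p\,dx=0\Big\}.$$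 A geodesic on $[\alpha,\beta]$ ($\alpha<\beta$) is a $C^2$ curve that is a critical point of the energy $\frac12\int_\alpha^\beta G(\dot\gamma,\dot\gamma)\,dt$ under all $C^2$ variations with fixed endpoints. **Theorem.** For $(q,p)\in T^*Q$, write $\eta=\eta(q)$, $\varphi=\varphi(q)$ and consider the first-order system on $T^*Q$, with time derivatives taken in $L^2([0,1])$, $$\begin{cases}\dot q=\eta\,p,\\[2pt] \dot p=-\dfrac12\displaystyle\int_x^1\eta\,p^2\,dy+\begin{bmatrix}1&\varphi\end{bmatrix}H_2^{-1}\begin{bmatrix}a\\ b+c\end{bmatrix},\end{cases}\qquad H_2=\begin{bmatrix}1&1/2\\1/2&1/3\end{bmatrix},\tag{$*$}$$ where $$a=\tfrac12\int_0^1 x\,p^2\circ\varphi^{-1}\,dx,\quad b=\tfrac32\int_0^1\Big(\int_0^x p\circ\varphi^{-1}\,dy\Big)^2dx,\quad c=\tfrac14\int_0^1 x^2\,p^2\circ\varphi^{-1}\,dx .$$ 1. A curve $q:[\alpha,\beta]\to L^2([0,1])$ is a geodesic of $(Q,G)$ if and only if there is a curve $p$ such that $(q,p)$ is a curve in $T^*Q$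 solving $(*)$ on $[\alpha,\beta]$. 2. If $\varphi\in\mathrm{Diff}_0^2([0,1])$ and $q=\partial_x\log\partial_x\varphi$, then $q\in Q$ and $\varphi(q)=\varphi$. A curve $t\mapsto\varphi_t$, $t\in[\alpha,\beta]$, in $\mathrm{Diff}_0^2([0,1])$ is a geodesic of the right-invariant metric if and only if there is a curve $p$ such that $(q,p)$, with $q(t)=\partial_x\log\partial_x\varphi_t$, is a curve in $T^*Q$ solving $(*)$. 3. The right-hand side of $(*)$ is tangent to $T^*Q$, and it is the Hamiltonian vector field of the kinetic energy $\mathcal H(q,p)=\frac12\int_0^1\eta(q)\,p^2\,dx$ for the canonical symplectic form of $T^*Q$ (the restriction of $dq\wedge dp$): it is the only tangent vector $V$ with $(dq\wedge dp)(V,W)=d\mathcal H(W)$ for all $W$ tangent to $T^*Q$ at $(q,p)$. -/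

import Mathlib

open Set Filter Topology MeasureTheory

noncomputable section

namespace DiffGeodesics

/-! ### The space `L²([0,1])` -/

/-- Lebesgue measure on `[0,1]`. -/
abbrev μI : Measure ℝ := volume.restrict (Icc (0 : ℝ) 1)

/-- The Hilbert space `L²([0,1])`. -/
abbrev L2 : Type := Lp ℝ 2 μI

/-! ### The space `H₀²([0,1])` -/

/-- `f ∈ H₀²([0,1])`: the `C¹` representative of `f`, extended by zero to the line.  It is
differentiable (so that `f` and `f'` vanish at `0` and at `1`), and `f'` is absolutely continuous
on `[0,1]` with `f'' ∈ L²([0,1])`. -/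
structure MemH02 (f : ℝ → ℝ) : Prop where
  eq_zero : ∀ x, x ∉ Icc (0 : ℝ) 1 → f x = 0
  differentiable : Differentiable ℝ f
  absCont : AbsolutelyContinuousOnInterval (deriv f) 0 1
  memLp : MemLp (deriv (deriv f)) 2 μI

lemma ae_differentiableAt_of_ac {g : ℝ → ℝ} (hg : AbsolutelyContinuousOnInterval g 0 1) :
    ∀ᵐ x ∂μI, DifferentiableAt ℝ g x := by
  rw [ae_restrict_iff' measurableSet_Icc]
  filter_upwards [hg.ae_differentiableAt] with x hx hx'
  exact hx (by rwa [uIcc_of_le zero_le_one])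

lemma MemH02.deriv2_add {f g : ℝ → ℝ} (hf : MemH02 f) (hg : MemH02 g) :
    deriv (deriv (f + g)) =ᵐ[μI] deriv (deriv f) + deriv (deriv g) := by
  have h1 : deriv (f + g) = deriv f + deriv g := by
    funext x
    exact deriv_add (hf.differentiable x) (hg.differentiable x)
  rw [h1]
  filter_upwards [ae_differentiableAt_of_ac hf.absCont, ae_differentiableAt_of_ac hg.absCont]
    with x hx hy
  exact deriv_add hx hy

lemma MemH02.deriv_smul' {f : ℝ → ℝ} (hf : MemH02 f) (c : ℝ) :
    deriv (c • f) = c • deriv f := by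
  funext x
  exact deriv_const_smul c (hf.differentiable x)

lemma MemH02.deriv2_smul {f : ℝ → ℝ} (hf : MemH02 f) (c : ℝ) :
    deriv (deriv (c • f)) =ᵐ[μI] c • deriv (deriv f) := by
  rw [hf.deriv_smul' c]
  filter_upwards [ae_differentiableAt_of_ac hf.absCont] with x hx
  exact deriv_const_smul c hx

lemma memH02_zero : MemH02 0 := by
  have h : deriv (0 : ℝ → ℝ) = 0 := by
    funext x
    simp
  refine ⟨fun _ _ => rfl, differentiable_const 0, ?_, ?_⟩
  · rw [h]
    exact (contDiff_const (c := (0 : ℝ))).contDiffOn.absolutelyContinuousOnInterval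
  · rw [h, h]
    exact MemLp.zero

/-- `H₀²([0,1])` as a space of functions. -/
def H02Submodule : Submodule ℝ (ℝ → ℝ) where
  carrier := {f | MemH02 f}
  zero_mem' := memH02_zero
  add_mem' := by
    intro f g hf hg
    refine ⟨fun x hx => ?_, hf.differentiable.add hg.differentiable, ?_, ?_⟩
    · simp [hf.eq_zero x hx, hg.eq_zero x hx]
    · have h1 : deriv (f + g) = deriv f + deriv g := by
        funext x
        exact deriv_add (hf.differentiable x) (hg.differentiable x)
      rw [h1]
      exact hf.absCont.add hg.absCont
    · exact (hf.memLp.add hg.memLp).ae_eq (hf.deriv2_add hg).symm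
  smul_mem' := by
    intro c f hf
    refine ⟨fun x hx => ?_, hf.differentiable.const_smul c, ?_, ?_⟩
    · simp [hf.eq_zero x hx]
    · rw [hf.deriv_smul' c]
      exact hf.absCont.const_smul c
    · exact (hf.memLp.const_smul c).ae_eq (hf.deriv2_smul c).symm

/-- The space `H₀²([0,1])`; its norm is introduced below. -/
def H02 : Type := H02Submodule

instance : AddCommGroup H02 := inferInstanceAs (AddCommGroup H02Submodule)
instance : Module ℝ H02 := inferInstanceAs (Module ℝ H02Submodule)
instance : CoeFun H02 (fun _ => ℝ → ℝ) := ⟨fun f => Subtype.val f⟩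

lemma H02.memH02 (f : H02) : MemH02 f := f.2

/-- The second derivative `H₀²([0,1]) → L²([0,1])`. -/
def secondDeriv : H02 →ₗ[ℝ] L2 where
  toFun f := f.memH02.memLp.toLp (deriv (deriv f))
  map_add' f g := by
    rw [← MemLp.toLp_add]
    exact (MemLp.toLp_eq_toLp_iff _ _).2 (f.memH02.deriv2_add g.memH02)
  map_smul' c f := by
    rw [RingHom.id_apply, ← MemLp.toLp_const_smul]
    exact (MemLp.toLp_eq_toLp_iff _ _).2 (f.memH02.deriv2_smul c)

lemma MemH02.apply_zero {f : ℝ → ℝ} (hf : MemH02 f) : f 0 = 0 := by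
  have hc : Tendsto f (𝓝[<] 0) (𝓝 (f 0)) :=
    (hf.differentiable.continuous.tendsto 0).mono_left nhdsWithin_le_nhds
  have hz : Tendsto f (𝓝[<] 0) (𝓝 0) := by
    refine tendsto_const_nhds.congr' ?_
    filter_upwards [self_mem_nhdsWithin] with x hx
    exact (hf.eq_zero x (fun h => absurd h.1 (not_le.2 hx))).symm
  exact tendsto_nhds_unique hc hz

lemma MemH02.deriv_eq_zero {f : ℝ → ℝ} (hf : MemH02 f) : deriv f 0 = 0 := by
  have h1 : Tendsto (slope f 0) (𝓝[<] 0) (𝓝 (deriv f 0)) :=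
    (hasDerivAt_iff_tendsto_slope.1 (hf.differentiable 0).hasDerivAt).mono_left
      (nhdsWithin_mono _ (fun x hx => ne_of_lt hx))
  have h0 := hf.apply_zero
  have h2 : Tendsto (slope f 0) (𝓝[<] 0) (𝓝 0) := by
    refine tendsto_const_nhds.congr' ?_
    filter_upwards [self_mem_nhdsWithin] with x hx
    simp [slope_def_field, h0, hf.eq_zero x (fun h => absurd h.1 (not_le.2 hx))]
  exact tendsto_nhds_unique h1 h2

lemma secondDeriv_injective : Function.Injective secondDeriv := by
  rw [← LinearMap.ker_eq_bot, LinearMap.ker_eq_bot']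
  intro f hf
  have hf' := f.memH02
  have h0 : deriv (deriv f) =ᵐ[μI] 0 := by
    have := (MemLp.coeFn_toLp hf'.memLp).symm
    refine this.trans ?_
    change ⇑(secondDeriv f) =ᵐ[μI] 0
    rw [hf]
    exact Lp.coeFn_zero _ _ _
  have h1 : ∀ x ∈ Icc (0 : ℝ) 1, deriv f x = 0 := by
    intro x hx
    have hac : AbsolutelyContinuousOnInterval (deriv f) 0 x := by
      refine hf'.absCont.mono ?_
      rw [uIcc_of_le hx.1, uIcc_of_le zero_le_one]
      exact Icc_subset_Icc_right hx.2
    have hint := hac.integral_deriv_eq_sub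
    rw [hf'.deriv_eq_zero, sub_zero] at hint
    rw [← hint]
    apply intervalIntegral.integral_zero_ae
    rw [Filter.EventuallyEq, ae_restrict_iff' measurableSet_Icc] at h0
    filter_upwards [h0] with y hy hy'
    rw [uIoc_of_le hx.1] at hy'
    exact hy ⟨hy'.1.le, hy'.2.trans hx.2⟩
  have h2 : ∀ x, (f : ℝ → ℝ) x = 0 := by
    intro x
    by_cases hx : x ∈ Icc (0 : ℝ) 1
    · have hc := (convex_Icc (0 : ℝ) 1).is_const_of_fderivWithin_eq_zero (𝕜 := ℝ)
        (f := (f : ℝ → ℝ)) (fun y _ => (hf'.differentiable y).differentiableWithinAt) ?_ hx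
        (left_mem_Icc.2 zero_le_one)
      · rw [hc, hf'.apply_zero]
      · intro y hy
        rw [(hf'.differentiable y).fderivWithin (uniqueDiffOn_Icc zero_lt_one y hy)]
        ext
        simp [h1 y hy]
    · exact hf'.eq_zero x hx
  exact Subtype.ext (funext h2)

/-- The norm `‖f‖ = ‖f''‖_{L²}` of `H₀²([0,1])`. -/
instance : NormedAddCommGroup H02 :=
  NormedAddCommGroup.induced H02 L2 secondDeriv secondDeriv_injective

instance : NormedSpace ℝ H02 := NormedSpace.induced ℝ H02 L2 secondDeriv

/-! ### The group of diffeomorphisms and its right-invariant metric -/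

/-- The map `Id + f`. -/
def toMap (f : H02) (x : ℝ) : ℝ := x + f x

/-- `Diff₀²([0,1])`; the diffeomorphism `φ = Id + f` is represented by `f ∈ H₀²([0,1])`, so that
this is an open subset of `H₀²([0,1])`, whose tangent spaces are all `H₀²([0,1])`. -/
def Diff02 : Set H02 := {f | ∀ x ∈ Icc (0 : ℝ) 1, 0 < 1 + deriv f x}

/-- The inner product `⟨u, v⟩ = ∫₀¹ u'' v'' dx` of `H₀²([0,1])`. -/
def innerH02 (u v : ℝ → ℝ) : ℝ := ∫ x in (0 : ℝ)..1, deriv (deriv u) x * deriv (deriv v) x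

/-- The right-invariant metric `G_φ(X, Y) = ⟨X ∘ φ⁻¹, Y ∘ φ⁻¹⟩`, where `φ = Id + f`. -/
def rightInvMetric (f X Y : H02) : ℝ :=
  innerH02 (fun y => X (Function.invFun (toMap f) y)) (fun y => Y (Function.invFun (toMap f) y))

lemma memLp_logDeriv {f : H02} (hf : f ∈ Diff02) :
    MemLp (deriv fun x => Real.log (deriv (toMap f) x)) 2 μI := by
  have hf' := f.memH02
  have hd : deriv (toMap f) = fun x => 1 + deriv f x := by
    funext x
    exact ((hasDerivAt_id x).add (hf'.differentiable x).hasDerivAt).deriv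
  have hcont : ContinuousOn (fun x => (1 + deriv f x)⁻¹) (Icc 0 1) := by
    have := hf'.absCont.continuousOn
    rw [uIcc_of_le zero_le_one] at this
    exact (continuousOn_const.add this).inv₀ (fun x hx => (hf x hx).ne')
  obtain ⟨C, hC⟩ := isCompact_Icc.exists_bound_of_continuousOn hcont
  have key : deriv (fun x => Real.log (deriv (toMap f) x)) =ᵐ[μI]
      fun x => (1 + deriv f x)⁻¹ * deriv (deriv f) x := by
    filter_upwards [ae_differentiableAt_of_ac hf'.absCont, ae_restrict_mem measurableSet_Icc]
      with x hx hx'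
    rw [hd]
    have h := ((hx.hasDerivAt.const_add 1).log (hf x hx').ne').deriv
    rw [h, div_eq_inv_mul]
  refine MemLp.ae_eq key.symm ?_
  refine MemLp.of_le_mul (c := C) hf'.memLp ?_ ?_
  · exact (hcont.aestronglyMeasurable measurableSet_Icc).mul hf'.memLp.1
  · filter_upwards [ae_restrict_mem measurableSet_Icc] with x hx
    rw [norm_mul]
    exact mul_le_mul_of_nonneg_right (hC x hx) (norm_nonneg _)

open Classical in
/-- The change of variable `q = ∂ₓ (log ∂ₓφ) ∈ L²([0,1])`, for `φ = Id + f ∈ Diff₀²([0,1])`. -/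
def logDerivCoord (f : H02) : L2 :=
  if hf : f ∈ Diff02 then (memLp_logDeriv hf).toLp _ else 0

/-! ### The submanifold `Q` of `L²([0,1])`, its metric and its cotangent bundle -/

/-- `η(q)(x) = exp (∫₀ˣ q)`, for `x ∈ [0,1]`. -/
def eta (q : L2) (x : ℝ) : ℝ := Real.exp (∫ u in (0 : ℝ)..x, q u)

/-- `φ(q)(x) = ∫₀ˣ η(q)`, for `x ∈ [0,1]`. -/
def phi (q : L2) (x : ℝ) : ℝ := ∫ y in (0 : ℝ)..x, eta q y

/-- The inverse of `φ(q) : [0,1] → [0,1]`. -/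
def phiInv (q : L2) : ℝ → ℝ := Function.invFunOn (phi q) (Icc 0 1)

def Q : Set L2 :=
  {q | (∫ x in (0 : ℝ)..1, q x) = 0 ∧ (∫ x in (0 : ℝ)..1, Real.exp (∫ u in (0 : ℝ)..x, q u)) = 1}

/-- The metric `G(q)(X, Y) = ∫₀¹ X Y / η(q) dx`. -/
def metricQ (q X Y : L2) : ℝ := ∫ x in (0 : ℝ)..1, X x * Y x / eta q x

/-- The cotangent bundle of `Q`.  The tangent space `T_qQ` consists of the `X ∈ L²([0,1])` with
`∫ X = 0` and `∫ X φ(q) = 0`; by the metric, a covector at `q` is `Y ↦ ∫ p Y` for a unique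
`p = X / η(q)` with `X ∈ T_qQ`. -/
def cotangentQ : Set (L2 × L2) :=
  {z | z.1 ∈ Q ∧ (∫ x in (0 : ℝ)..1, eta z.1 x * z.2 x) = 0 ∧
    (∫ x in (0 : ℝ)..1, eta z.1 x * z.2 x * phi z.1 x) = 0}

/-- The kinetic energy on the cotangent bundle: half the squared norm of the covector `p`, that is,
`½ G(q)(X, X)` for `X = η(q) p`. -/
def hamiltonian (z : L2 × L2) : ℝ := (1 / 2) * ∫ x in (0 : ℝ)..1, eta z.1 x * z.2 x ^ 2

/-- The symplectic form `dq ∧ dp`, of which the canonical form of `T*Q` is the restriction. -/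
def symplecticForm (V W : L2 × L2) : ℝ := inner ℝ V.1 W.2 - inner ℝ V.2 W.1

/-! ### Geodesics -/

section Geodesics

variable {E : Type*} [NormedAddCommGroup E] [NormedSpace ℝ E]

/-- The energy `½ ∫ₐᵇ G_γ(γ̇, γ̇) dt` of a curve. -/
def energy (G : E → E → E → ℝ) (a b : ℝ) (γ : ℝ → E) : ℝ :=
  (1 / 2) * ∫ t in a..b,
    G (γ t) (derivWithin γ (Icc a b) t) (derivWithin γ (Icc a b) t)

/-- `Γ s t` (`|s| < ε`, `t ∈ [a,b]`) is a `C²` variation in `M`, with fixed endpoints, of the curve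
`γ`. -/
structure IsVariation (M : Set E) (a b : ℝ) (γ : ℝ → E) (ε : ℝ) (Γ : ℝ → ℝ → E) : Prop where
  contDiffOn : ContDiffOn ℝ 2 (fun z : ℝ × ℝ => Γ z.1 z.2) (Ioo (-ε) ε ×ˢ Icc a b)
  mem : ∀ s ∈ Ioo (-ε) ε, ∀ t ∈ Icc a b, Γ s t ∈ M
  eq_zero : ∀ t ∈ Icc a b, Γ 0 t = γ t
  eq_left : ∀ s ∈ Ioo (-ε) ε, Γ s a = γ a
  eq_right : ∀ s ∈ Ioo (-ε) ε, Γ s b = γ b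

/-- `γ : [a,b] → M` is a geodesic of the submanifold `M` for the metric `G`: a `C²` curve which is
a critical point of the energy among the curves in `M` with the same endpoints. -/
structure IsGeodesic (M : Set E) (G : E → E → E → ℝ) (a b : ℝ) (γ : ℝ → E) : Prop where
  mem : ∀ t ∈ Icc a b, γ t ∈ M
  contDiffOn : ContDiffOn ℝ 2 γ (Icc a b)
  critical : ∀ ε > 0, ∀ Γ : ℝ → ℝ → E, IsVariation M a b γ ε Γ →
    HasDerivAt (fun s => energy G a b (Γ s)) 0 0

end Geodesics

/-! ### The first-order system -/

/-- The Hilbert matrix `H₂`. -/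
def hilbertMatrix : Matrix (Fin 2) (Fin 2) ℝ := !![1, 1 / 2; 1 / 2, 1 / 3]

def coefA (q p : L2) : ℝ := (1 / 2) * ∫ x in (0 : ℝ)..1, x * p (phiInv q x) ^ 2

def coefB (q p : L2) : ℝ :=
  (3 / 2) * ∫ x in (0 : ℝ)..1, (∫ y in (0 : ℝ)..x, p (phiInv q y)) ^ 2

def coefC (q p : L2) : ℝ := (1 / 4) * ∫ x in (0 : ℝ)..1, x ^ 2 * p (phiInv q x) ^ 2

/-- `-½ ∫ₓ¹ η p² dy + [1 φ] H₂⁻¹ [a; b + c]`. -/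
def momentumField (q p : L2) (x : ℝ) : ℝ :=
  -(1 / 2) * (∫ y in x..1, eta q y * p y ^ 2) +
    ![1, phi q x] ⬝ᵥ (hilbertMatrix⁻¹.mulVec ![coefA q p, coefB q p + coefC q p])

/-- `X` is the value at `(q, p)` of the right-hand side of the system. -/
def IsFieldAt (q p : L2) (X : L2 × L2) : Prop :=
  (X.1 =ᵐ[μI] fun x => eta q x * p x) ∧ (X.2 =ᵐ[μI] momentumField q p)

/-- The curve `(q, p)` in `T*Q` solves, on `[a,b]`, the system `q̇ = η p`,
`ṗ = -½ ∫ₓ¹ η p² dy + [1 φ] H₂⁻¹ [a; b + c]`, the derivatives being taken in `L²([0,1])`. -/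
def IsHamiltonianSolution (a b : ℝ) (q p : ℝ → L2) : Prop :=
  ∀ t ∈ Icc a b, (q t, p t) ∈ cotangentQ ∧ ∃ X : L2 × L2, IsFieldAt (q t) (p t) X ∧
    HasDerivWithinAt q X.1 (Icc a b) t ∧ HasDerivWithinAt p X.2 (Icc a b) t

end DiffGeodesics

end

noncomputable section

namespace DiffGeodesics

/-!
The coordinate `q = ∂ₓ log ∂ₓφ` turns `1 + f'` into `η(q)` and the right-invariant metric into
`∫₀¹ XY / η(q)`, so that `Diff02` with its metric is a copy of `Q`. Moreover `∂ₓη(q) = q η(q) = f''`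
is a global chart in which the two equations of `Q` become linear; its straight lines provide enough
variations with fixed endpoints and enough tangent vectors.

With the momentum `p = q̇ / η(q)`, a critical point of the energy satisfies
`ṗ = -½ ∫ₓ¹ η(q) p²` up to the orthogonal complement of the tangent space, which is spanned by `1`
and `φ(q)`. The two coefficients are fixed by differentiating in time the constraints
`∫₀¹ η(q) p = ∫₀¹ η(q) φ(q) p = 0`: since `φ(q)` maps the weight `η(q)` to Lebesgue measure, the
Gram matrix of `1` and `φ(q)` for this weight is the Hilbert matrix `H₂`.

A tangent vector of `T*Q` is determined by its pairings under `dq ∧ dp`, and on vectors tangent to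
`T*Q` the multiplier of `1` and `φ(q)` does not contribute to the pairing, which leaves `d𝓗`.
-/

/-! ### Functions on a rectangle and their partial derivatives -/

section Rectangle

variable {E : Type*} [NormedAddCommGroup E] [NormedSpace ℝ E] {U T : Set ℝ} {s t : ℝ}

lemma hasDerivAt_left_of_hasFDerivWithinAt_prod {f : ℝ × ℝ → E} {f' : ℝ × ℝ →L[ℝ] E}
    (hU : U ∈ 𝓝 s) (ht : t ∈ T) (hf : HasFDerivWithinAt f f' (U ×ˢ T) (s, t)) :
    HasDerivAt (fun s => f (s, t)) (f' (1, 0)) s :=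
  (hf.comp_hasDerivWithinAt (f := fun s => (s, t)) s
    ((hasDerivWithinAt_id s U).prodMk (hasDerivWithinAt_const s U t))
    fun _ hs => ⟨hs, ht⟩).hasDerivAt hU

lemma hasDerivWithinAt_right_of_hasFDerivWithinAt_prod {f : ℝ × ℝ → E} {f' : ℝ × ℝ →L[ℝ] E}
    (hs : s ∈ U) (hf : HasFDerivWithinAt f f' (U ×ˢ T) (s, t)) :
    HasDerivWithinAt (fun t => f (s, t)) (f' (0, 1)) T t :=
  hf.comp_hasDerivWithinAt (f := fun t => (s, t)) t
    ((hasDerivWithinAt_const t T s).prodMk (hasDerivWithinAt_id t T)) fun _ ht => ⟨hs, ht⟩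

variable {f : ℝ → ℝ → E}

lemma deriv_left_eq_fderivWithin_prod (hU : IsOpen U) (hs : s ∈ U) (ht : t ∈ T)
    (hf : DifferentiableOn ℝ (fun z : ℝ × ℝ => f z.1 z.2) (U ×ˢ T)) :
    deriv (fun s => f s t) s = fderivWithin ℝ (fun z : ℝ × ℝ => f z.1 z.2) (U ×ˢ T) (s, t) (1, 0) :=
  (hasDerivAt_left_of_hasFDerivWithinAt_prod (hU.mem_nhds hs) ht
    (hf (s, t) ⟨hs, ht⟩).hasFDerivWithinAt).deriv

lemma derivWithin_right_eq_fderivWithin_prod (hT : UniqueDiffOn ℝ T) (hs : s ∈ U) (ht : t ∈ T)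
    (hf : DifferentiableOn ℝ (fun z : ℝ × ℝ => f z.1 z.2) (U ×ˢ T)) :
    derivWithin (f s) T t = fderivWithin ℝ (fun z : ℝ × ℝ => f z.1 z.2) (U ×ˢ T) (s, t) (0, 1) :=
  (hasDerivWithinAt_right_of_hasFDerivWithinAt_prod hs
    (hf (s, t) ⟨hs, ht⟩).hasFDerivWithinAt).derivWithin (hT t ht)

variable {m n : WithTop ℕ∞}

lemma contDiffOn_deriv_left (hU : IsOpen U) (hT : UniqueDiffOn ℝ T)
    (hf : ContDiffOn ℝ n (fun z : ℝ × ℝ => f z.1 z.2) (U ×ˢ T)) (hmn : m + 1 ≤ n) :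
    ContDiffOn ℝ m (fun z : ℝ × ℝ => deriv (fun s => f s z.2) z.1) (U ×ˢ T) := by
  have hn : n ≠ 0 := fun h => by simp [h] at hmn
  refine ((hf.fderivWithin (hU.uniqueDiffOn.prod hT) hmn).clm_apply
    (contDiffOn_const (c := ((1 : ℝ), (0 : ℝ))))).congr fun z hz => ?_
  exact deriv_left_eq_fderivWithin_prod hU hz.1 hz.2 (hf.differentiableOn hn)

lemma contDiffOn_derivWithin_right (hU : IsOpen U) (hT : UniqueDiffOn ℝ T)
    (hf : ContDiffOn ℝ n (fun z : ℝ × ℝ => f z.1 z.2) (U ×ˢ T)) (hmn : m + 1 ≤ n) :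
    ContDiffOn ℝ m (fun z : ℝ × ℝ => derivWithin (f z.1) T z.2) (U ×ˢ T) := by
  have hn : n ≠ 0 := fun h => by simp [h] at hmn
  refine ((hf.fderivWithin (hU.uniqueDiffOn.prod hT) hmn).clm_apply
    (contDiffOn_const (c := ((0 : ℝ), (1 : ℝ))))).congr fun z hz => ?_
  exact derivWithin_right_eq_fderivWithin_prod hT hz.1 hz.2 (hf.differentiableOn hn)

lemma contDiffOn_right_of_prod (hs : s ∈ U)
    (hf : ContDiffOn ℝ n (fun z : ℝ × ℝ => f z.1 z.2) (U ×ˢ T)) : ContDiffOn ℝ n (f s) T :=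
  hf.comp (contDiff_const.prodMk contDiff_id).contDiffOn fun _ ht => ⟨hs, ht⟩

theorem deriv_derivWithin_comm (hU : IsOpen U) (hT : UniqueDiffOn ℝ T)
    (hT' : T ⊆ closure (interior T))
    (hf : ContDiffOn ℝ 2 (fun z : ℝ × ℝ => f z.1 z.2) (U ×ˢ T)) (hs : s ∈ U) (ht : t ∈ T) :
    deriv (fun s => derivWithin (f s) T t) s =
      derivWithin (fun t => deriv (fun s => f s t) s) T t := by
  set A := fderivWithin ℝ (fun z : ℝ × ℝ => f z.1 z.2) (U ×ˢ T)
  have hST : UniqueDiffOn ℝ (U ×ˢ T) := hU.uniqueDiffOn.prod hT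
  have hd : DifferentiableOn ℝ (fun z : ℝ × ℝ => f z.1 z.2) (U ×ˢ T) :=
    hf.differentiableOn (by norm_num)
  have hA : HasFDerivWithinAt A (fderivWithin ℝ A (U ×ˢ T) (s, t)) (U ×ˢ T) (s, t) :=
    ((hf.fderivWithin (m := 1) hST (by norm_num)).differentiableOn (by norm_num) (s, t)
      ⟨hs, ht⟩).hasFDerivWithinAt
  have hl : deriv (fun s => derivWithin (f s) T t) s =
      fderivWithin ℝ A (U ×ˢ T) (s, t) (1, 0) (0, 1) := by
    refine (((hasDerivAt_left_of_hasFDerivWithinAt_prod (hU.mem_nhds hs) ht hA).clm_apply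
      (hasDerivAt_const s ((0 : ℝ), (1 : ℝ)))).congr_of_eventuallyEq ?_).deriv.trans (by simp)
    filter_upwards [hU.mem_nhds hs] with s hs
    exact derivWithin_right_eq_fderivWithin_prod hT hs ht hd
  have hr : derivWithin (fun t => deriv (fun s => f s t) s) T t =
      fderivWithin ℝ A (U ×ˢ T) (s, t) (0, 1) (1, 0) := by
    refine (((hasDerivWithinAt_right_of_hasFDerivWithinAt_prod hs hA).clm_apply
      (hasDerivWithinAt_const t T ((1 : ℝ), (0 : ℝ)))).congr (fun t ht => ?_) ?_).derivWithin
        (hT t ht) |>.trans (by simp)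
    all_goals exact deriv_left_eq_fderivWithin_prod hU hs ht hd
  rw [hl, hr]
  refine (hf (s, t) ⟨hs, ht⟩).isSymmSndFDerivWithinAt (by simp) hST ?_ ⟨hs, ht⟩ _ _
  rw [interior_prod_eq, hU.interior_eq, closure_prod_eq]
  exact ⟨subset_closure hs, hT' ht⟩

theorem hasDerivAt_intervalIntegral_of_contDiffOn {a b : ℝ} (hU : IsOpen U) (hab : a < b)
    (hf : ContDiffOn ℝ 1 (fun z : ℝ × ℝ => f z.1 z.2) (U ×ˢ Icc a b)) (hs : s ∈ U) :
    HasDerivAt (fun s => ∫ t in a..b, f s t) (∫ t in a..b, deriv (fun s => f s t) s) s := by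
  have hf' : ContinuousOn (fun z : ℝ × ℝ => deriv (fun s => f s z.2) z.1) (U ×ˢ Icc a b) :=
    (contDiffOn_deriv_left (m := 0) hU (uniqueDiffOn_Icc hab) hf (by norm_num)).continuousOn
  have hsub : uIoc a b ⊆ Icc a b := by rw [uIoc_of_le hab.le]; exact Ioc_subset_Icc_self
  obtain ⟨K, hK, hKU, hKc⟩ := local_compact_nhds (hU.mem_nhds hs)
  obtain ⟨C, hC⟩ := (hKc.prod isCompact_Icc).exists_bound_of_continuousOn
    (hf'.mono (prod_mono_left hKU))
  refine (intervalIntegral.hasDerivAt_integral_of_dominated_loc_of_deriv_le (μ := volume)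
    (F := f) (F' := fun s t => deriv (fun s => f s t) s) (a := a) (b := b) (bound := fun _ => C)
    hK ?_ ?_ ?_ ?_ intervalIntegrable_const ?_).2
  · filter_upwards [hU.mem_nhds hs] with s hs
    exact ((contDiffOn_right_of_prod hs hf).continuousOn.mono hsub).aestronglyMeasurable
      measurableSet_uIoc
  · exact (contDiffOn_right_of_prod hs hf).continuousOn.intervalIntegrable_of_Icc hab.le
  · exact (hf'.comp (Continuous.prodMk_right s).continuousOn
      fun t ht => ⟨hs, hsub ht⟩).aestronglyMeasurable measurableSet_uIoc
  · exact Eventually.of_forall fun t ht s hs => hC (s, t) ⟨hs, hsub ht⟩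
  · refine Eventually.of_forall fun t ht s hs => ?_
    exact (hasDerivAt_left_of_hasFDerivWithinAt_prod (hU.mem_nhds (hKU hs)) (hsub ht)
      (hf.differentiableOn one_ne_zero (s, t)
        ⟨hKU hs, hsub ht⟩).hasFDerivWithinAt).differentiableAt.hasDerivAt

end Rectangle

/-! ### Calculus of variations -/

section Variation

variable {E F : Type*} [NormedAddCommGroup E] [NormedSpace ℝ E] [NormedAddCommGroup F]
  [NormedSpace ℝ F] {M : Set E} {N : Set F} {a b ε : ℝ} {γ : ℝ → E} {Γ : ℝ → ℝ → E}

/-- The infinitesimal variation `t ↦ ∂ₛ Γ(s, t)` at `s = 0` of a family of curves. -/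
def variationField (Γ : ℝ → ℝ → E) (t : ℝ) : E := deriv (fun s => Γ s t) 0

lemma eventually_mem_Ioo_neg (hε : 0 < ε) : ∀ᶠ s in 𝓝 (0 : ℝ), s ∈ Ioo (-ε) ε :=
  Ioo_mem_nhds (neg_lt_zero.2 hε) hε

namespace IsVariation

lemma contDiffOn_curve (hΓ : IsVariation M a b γ ε Γ) {s : ℝ} (hs : s ∈ Ioo (-ε) ε) :
    ContDiffOn ℝ 2 (Γ s) (Icc a b) :=
  contDiffOn_right_of_prod hs hΓ.contDiffOn

lemma hasDerivAt (hΓ : IsVariation M a b γ ε Γ) (hε : 0 < ε) {t : ℝ} (ht : t ∈ Icc a b) :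
    HasDerivAt (fun s => Γ s t) (variationField Γ t) 0 :=
  (hasDerivAt_left_of_hasFDerivWithinAt_prod (eventually_mem_Ioo_neg hε) ht
    (hΓ.contDiffOn.differentiableOn (by norm_num) (0, t)
      ⟨⟨neg_lt_zero.2 hε, hε⟩, ht⟩).hasFDerivWithinAt).differentiableAt.hasDerivAt

lemma contDiffOn_variationField (hΓ : IsVariation M a b γ ε Γ) (hab : a < b) (hε : 0 < ε) :
    ContDiffOn ℝ 1 (variationField Γ) (Icc a b) :=
  contDiffOn_right_of_prod (f := fun s t => deriv (fun s => Γ s t) s)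
    (eventually_mem_Ioo_neg hε).self_of_nhds
    (contDiffOn_deriv_left isOpen_Ioo (uniqueDiffOn_Icc hab) hΓ.contDiffOn (by norm_num))

lemma variationField_left (hΓ : IsVariation M a b γ ε Γ) (hε : 0 < ε) :
    variationField Γ a = 0 := by
  have h : (fun s => Γ s a) =ᶠ[𝓝 0] fun _ => γ a := by
    filter_upwards [eventually_mem_Ioo_neg hε] using hΓ.eq_left
  rw [variationField, h.deriv_eq, deriv_const]

lemma variationField_right (hΓ : IsVariation M a b γ ε Γ) (hε : 0 < ε) :
    variationField Γ b = 0 := by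
  have h : (fun s => Γ s b) =ᶠ[𝓝 0] fun _ => γ b := by
    filter_upwards [eventually_mem_Ioo_neg hε] using hΓ.eq_right
  rw [variationField, h.deriv_eq, deriv_const]

lemma hasDerivAt_derivWithin (hΓ : IsVariation M a b γ ε Γ) (hab : a < b) (hε : 0 < ε) {t : ℝ}
    (ht : t ∈ Icc a b) : HasDerivAt (fun s => derivWithin (Γ s) (Icc a b) t)
      (derivWithin (variationField Γ) (Icc a b) t) 0 := by
  have h0 : (0 : ℝ) ∈ Ioo (-ε) ε := ⟨neg_lt_zero.2 hε, hε⟩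
  have hT : Icc a b ⊆ closure (interior (Icc a b)) := by
    rw [interior_Icc, closure_Ioo hab.ne]
  have hd := (contDiffOn_derivWithin_right (m := 1) isOpen_Ioo (uniqueDiffOn_Icc hab)
    hΓ.contDiffOn (by norm_num)).differentiableOn one_ne_zero (0, t) ⟨h0, ht⟩
  refine (hasDerivAt_left_of_hasFDerivWithinAt_prod (eventually_mem_Ioo_neg hε) ht
    hd.hasFDerivWithinAt).differentiableAt.hasDerivAt.congr_deriv ?_
  exact deriv_derivWithin_comm isOpen_Ioo (uniqueDiffOn_Icc hab) hT hΓ.contDiffOn h0 ht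

theorem hasDerivAt_integral_lagrangian (hΓ : IsVariation M a b γ ε Γ) (hab : a < b) (hε : 0 < ε)
    {L : E × E → ℝ} (hL : ContDiff ℝ 1 L) :
    HasDerivAt (fun s => ∫ t in a..b, L (Γ s t, derivWithin (Γ s) (Icc a b) t))
      (∫ t in a..b, fderiv ℝ L (γ t, derivWithin γ (Icc a b) t)
        (variationField Γ t, derivWithin (variationField Γ) (Icc a b) t)) 0 := by
  have hsmooth : ContDiffOn ℝ 1
      (fun z : ℝ × ℝ => L (Γ z.1 z.2, derivWithin (Γ z.1) (Icc a b) z.2))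
      (Ioo (-ε) ε ×ˢ Icc a b) :=
    hL.comp_contDiffOn ((hΓ.contDiffOn.of_le (by norm_num)).prodMk
      (contDiffOn_derivWithin_right isOpen_Ioo (uniqueDiffOn_Icc hab) hΓ.contDiffOn (by norm_num)))
  refine (hasDerivAt_intervalIntegral_of_contDiffOn
    (f := fun s t => L (Γ s t, derivWithin (Γ s) (Icc a b) t)) isOpen_Ioo hab hsmooth
    (eventually_mem_Ioo_neg hε).self_of_nhds).congr_deriv ?_
  refine intervalIntegral.integral_congr fun t ht => ?_
  rw [uIcc_of_le hab.le] at ht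
  have hγ : (γ t, derivWithin γ (Icc a b) t) = (Γ 0 t, derivWithin (Γ 0) (Icc a b) t) := by
    rw [hΓ.eq_zero t ht, derivWithin_congr hΓ.eq_zero (hΓ.eq_zero t ht)]
  simp only [hγ]
  exact ((hL.differentiable one_ne_zero _).hasFDerivAt.comp_hasDerivAt (0 : ℝ)
    ((hΓ.hasDerivAt hε ht).prodMk (hΓ.hasDerivAt_derivWithin hab hε ht))).deriv

lemma comp {Φ : E → F} (hΓ : IsVariation M a b γ ε Γ) (hΦ : ∀ x ∈ M, ContDiffAt ℝ 2 Φ x)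
    (hMN : MapsTo Φ M N) : IsVariation N a b (fun t => Φ (γ t)) ε (fun s t => Φ (Γ s t)) where
  contDiffOn z hz := (hΦ _ (hΓ.mem z.1 hz.1 z.2 hz.2)).comp_contDiffWithinAt z (hΓ.contDiffOn z hz)
  mem s hs t ht := hMN (hΓ.mem s hs t ht)
  eq_zero t ht := congrArg Φ (hΓ.eq_zero t ht)
  eq_left s hs := congrArg Φ (hΓ.eq_left s hs)
  eq_right s hs := congrArg Φ (hΓ.eq_right s hs)

lemma congr_curve (hΓ : IsVariation M a b γ ε Γ) (hab : a ≤ b) {γ' : ℝ → E}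
    (h : EqOn γ γ' (Icc a b)) : IsVariation M a b γ' ε Γ where
  contDiffOn := hΓ.contDiffOn
  mem := hΓ.mem
  eq_zero t ht := (hΓ.eq_zero t ht).trans (h ht)
  eq_left s hs := (hΓ.eq_left s hs).trans (h (left_mem_Icc.2 hab))
  eq_right s hs := (hΓ.eq_right s hs).trans (h (right_mem_Icc.2 hab))

end IsVariation

lemma energy_congr (G : E → E → E → ℝ) (hab : a ≤ b) {c c' : ℝ → E} (h : EqOn c c' (Icc a b)) :
    energy G a b c = energy G a b c' := by
  rw [energy, energy]
  congr 1
  refine intervalIntegral.integral_congr fun t ht => ?_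
  rw [uIcc_of_le hab] at ht
  simp only [derivWithin_congr h (h ht), h ht]

section Isometry

variable {G : E → E → E → ℝ} {G' : F → F → F → ℝ} {Φ : E → F} {Ψ : F → E}

lemma energy_comp_of_isometry (hΦ : ∀ x ∈ M, DifferentiableAt ℝ Φ x)
    (hG : ∀ x ∈ M, ∀ X, G' (Φ x) (fderiv ℝ Φ x X) (fderiv ℝ Φ x X) = G x X X) (hab : a < b)
    {c : ℝ → E} (hc : MapsTo c (Icc a b) M) (hd : DifferentiableOn ℝ c (Icc a b)) :
    energy G' a b (fun t => Φ (c t)) = energy G a b c := by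
  rw [energy, energy]
  congr 1
  refine intervalIntegral.integral_congr fun t ht => ?_
  rw [uIcc_of_le hab.le] at ht
  have h := (hΦ _ (hc ht)).hasFDerivAt.comp_hasDerivWithinAt t (hd t ht).hasDerivWithinAt
  simp only [← Function.comp_def Φ, h.derivWithin (uniqueDiffOn_Icc hab t ht)]
  exact hG _ (hc ht) _

lemma IsGeodesic.of_comp (hΦ : ∀ x ∈ M, ContDiffAt ℝ 2 Φ x) (hΨ : ∀ y ∈ N, ContDiffAt ℝ 2 Ψ y)
    (hMN : MapsTo Φ M N) (hΨΦ : LeftInvOn Ψ Φ M)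
    (hG : ∀ x ∈ M, ∀ X, G' (Φ x) (fderiv ℝ Φ x X) (fderiv ℝ Φ x X) = G x X X) (hab : a < b)
    (hγ : MapsTo γ (Icc a b) M) (h : IsGeodesic N G' a b fun t => Φ (γ t)) :
    IsGeodesic M G a b γ := by
  have hc : ContDiffOn ℝ 2 (fun t => Ψ (Φ (γ t))) (Icc a b) := fun t ht =>
    (hΨ _ (h.mem t ht)).comp_contDiffWithinAt t (h.contDiffOn t ht)
  refine ⟨hγ, hc.congr fun t ht => (hΨΦ (hγ ht)).symm, fun ε hε Γ hΓ => ?_⟩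
  refine (h.critical ε hε _ (hΓ.comp hΦ hMN)).congr_of_eventuallyEq ?_
  filter_upwards [eventually_mem_Ioo_neg hε] with s hs
  exact (energy_comp_of_isometry (fun x hx => (hΦ x hx).differentiableAt (by norm_num)) hG hab
    (hΓ.mem s hs) ((hΓ.contDiffOn_curve hs).differentiableOn (by norm_num))).symm

lemma IsGeodesic.comp (hΦ : ∀ x ∈ M, ContDiffAt ℝ 2 Φ x) (hΨ : ∀ y ∈ N, ContDiffAt ℝ 2 Ψ y)
    (hMN : MapsTo Φ M N) (hNM : MapsTo Ψ N M) (hΨΦ : LeftInvOn Ψ Φ M) (hΦΨ : LeftInvOn Φ Ψ N)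
    (hG : ∀ x ∈ M, ∀ X, G' (Φ x) (fderiv ℝ Φ x X) (fderiv ℝ Φ x X) = G x X X) (hab : a < b)
    (h : IsGeodesic M G a b γ) : IsGeodesic N G' a b fun t => Φ (γ t) := by
  refine ⟨fun t ht => hMN (h.mem t ht), fun t ht =>
    (hΦ _ (h.mem t ht)).comp_contDiffWithinAt t (h.contDiffOn t ht), fun ε hε Γ hΓ => ?_⟩
  have hΓ' : IsVariation M a b γ ε fun s t => Ψ (Γ s t) :=
    (hΓ.comp hΨ hNM).congr_curve hab.le fun t ht => hΨΦ (h.mem t ht)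
  refine (h.critical ε hε _ hΓ').congr_of_eventuallyEq ?_
  filter_upwards [eventually_mem_Ioo_neg hε] with s hs
  rw [← energy_comp_of_isometry (fun x hx => (hΦ x hx).differentiableAt (by norm_num)) hG hab
    (hΓ'.mem s hs) ((hΓ'.contDiffOn_curve hs).differentiableOn (by norm_num))]
  exact energy_congr G' hab.le fun t ht => (hΦΨ (hΓ.mem s hs t ht)).symm

end Isometry

end Variation

/-! ### Curves and tangent vectors -/

section Curves

variable {E F : Type*} [NormedAddCommGroup E] [NormedSpace ℝ E] [NormedAddCommGroup F]
  [NormedSpace ℝ F]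

lemma hasDerivAt_const_add_smul (x v : E) (t : ℝ) : HasDerivAt (fun s : ℝ => x + s • v) v t := by
  simpa using ((hasDerivAt_id t).smul_const v).const_add x

lemma mem_tangentConeAt_of_hasDerivWithinAt {s : Set E} {T : Set ℝ} {t : ℝ} {c : ℝ → E} {v : E}
    (hT : UniqueDiffWithinAt ℝ T t) (hc : HasDerivWithinAt c v T t) (hs : MapsTo c T s) :
    v ∈ tangentConeAt ℝ s (c t) := by
  have hone : (1 : ℝ) ∈ tangentConeAt ℝ T t :=
    tangentConeAt_eq_univ (uniqueDiffWithinAt_iff_accPt.1 hT) ▸ mem_univ 1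
  simpa using tangentConeAt_mono hs.image_subset (hc.hasFDerivWithinAt.mapsTo_tangent_cone hone)

lemma apply_eq_zero_of_mem_tangentConeAt {s : Set E} {x v : E} (hv : v ∈ tangentConeAt ℝ s x)
    {f : E → F} {f' : E →L[ℝ] F} (hf : HasFDerivWithinAt f f' s x) {y : F}
    (hs : EqOn f (fun _ => y) s) : f' v = 0 := by
  have h : f' v ∈ tangentConeAt ℝ {y} (f x) :=
    tangentConeAt_mono (image_subset_iff.2 hs) (hf.mapsTo_tangent_cone hv)
  simpa using tangentConeAt_subset_zero (mt Set.Infinite.of_accPt (by simp)) h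

lemma contDiffOn_one_of_hasDerivWithinAt {T : Set ℝ} {c c' : ℝ → E} (hT : UniqueDiffOn ℝ T)
    (hc : ∀ t ∈ T, HasDerivWithinAt c (c' t) T t) (hc' : ContinuousOn c' T) :
    ContDiffOn ℝ 1 c T := by
  rw [contDiffOn_one_iff_derivWithin hT]
  exact ⟨fun t ht => (hc t ht).differentiableWithinAt,
    hc'.congr fun t ht => (hc t ht).derivWithin (hT t ht)⟩

end Curves

/-! ### Integration by parts and the fundamental lemma of the calculus of variations -/

lemma integral_inner_derivWithin {E : Type*} [NormedAddCommGroup E] [InnerProductSpace ℝ E]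
    {a b : ℝ} (hab : a < b) {u v : ℝ → E} (hu : ContDiffOn ℝ 1 u (Icc a b))
    (hv : ContDiffOn ℝ 1 v (Icc a b)) (ha : v a = 0) (hb : v b = 0) :
    ∫ t in a..b, inner ℝ (u t) (derivWithin v (Icc a b) t) =
      -∫ t in a..b, inner ℝ (derivWithin u (Icc a b) t) (v t) := by
  have hT := uniqueDiffOn_Icc hab
  have i1 : IntervalIntegrable (fun t => inner ℝ (u t) (derivWithin v (Icc a b) t)) volume a b :=
    (hu.continuousOn.inner (hv.continuousOn_derivWithin hT le_rfl)).intervalIntegrable_of_Icc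
      hab.le
  have i2 : IntervalIntegrable (fun t => inner ℝ (derivWithin u (Icc a b) t) (v t)) volume a b :=
    ((hu.continuousOn_derivWithin hT le_rfl).inner hv.continuousOn).intervalIntegrable_of_Icc
      hab.le
  have h := intervalIntegral.integral_eq_sub_of_hasDerivAt_of_le hab.le
    (hu.continuousOn.inner hv.continuousOn) (fun t ht =>
      ((hu.differentiableOn one_ne_zero t (Ioo_subset_Icc_self ht)).hasDerivWithinAt.inner ℝ
        (hv.differentiableOn one_ne_zero t (Ioo_subset_Icc_self ht)).hasDerivWithinAt).hasDerivAt
          (Icc_mem_nhds ht.1 ht.2)) (i1.add i2)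
  rw [intervalIntegral.integral_add i1 i2, ha, hb, inner_zero_right, inner_zero_right] at h
  linarith

theorem eq_zero_of_integral_smooth_mul_eq_zero {a b : ℝ} (hab : a < b) {g : ℝ → ℝ}
    (hg : ContinuousOn g (Icc a b))
    (h : ∀ χ : ℝ → ℝ, ContDiff ℝ (⊤ : ℕ∞) χ → χ a = 0 → χ b = 0 → ∫ t in a..b, χ t * g t = 0) :
    EqOn g 0 (Icc a b) := by
  have hae : ∀ᵐ t, t ∈ Ioo a b → g t = 0 := by
    refine isOpen_Ioo.ae_eq_zero_of_integral_contDiff_smul_eq_zero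
      ((hg.mono Ioo_subset_Icc_self).locallyIntegrableOn measurableSet_Ioo) fun χ hχ _ hsupp => ?_
    have hz : ∀ t, t ∉ Ioo a b → χ t = 0 := fun t ht =>
      image_eq_zero_of_notMem_tsupport fun h => ht (hsupp h)
    have hintegral := h χ hχ (hz a (by simp)) (hz b (by simp))
    rwa [intervalIntegral.integral_of_le hab.le, setIntegral_eq_integral_of_forall_compl_eq_zero]
      at hintegral
    intro t ht
    rw [hz t fun h => ht (Ioo_subset_Ioc_self h), zero_mul]
  have hIoo : EqOn g 0 (Ioo a b) :=
    Measure.eqOn_open_of_ae_eq ((ae_restrict_iff' measurableSet_Ioo).2 hae) isOpen_Ioo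
      (hg.mono Ioo_subset_Icc_self) continuousOn_const
  rw [← closure_Ioo hab.ne] at hg ⊢
  exact hIoo.of_subset_closure hg continuousOn_const subset_closure subset_rfl

/-! ### Absolute continuity -/

lemma absolutelyContinuousOnInterval_congr {X : Type*} [PseudoMetricSpace X] {f g : ℝ → X}
    {a b : ℝ} (hf : AbsolutelyContinuousOnInterval f a b) (h : EqOn f g (uIcc a b)) :
    AbsolutelyContinuousOnInterval g a b := by
  rw [absolutelyContinuousOnInterval_iff] at hf ⊢
  intro ε hε
  obtain ⟨δ, hδ, hf⟩ := hf ε hε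
  refine ⟨δ, hδ, fun J hJ hJδ => (Finset.sum_congr rfl fun i hi => ?_).trans_lt (hf J hJ hJδ)⟩
  rw [h (hJ.1 i hi).1, h (hJ.1 i hi).2]

lemma absolutelyContinuousOnInterval_comp_of_lipschitzOnWith {X Y : Type*}
    [PseudoMetricSpace X] [PseudoMetricSpace Y] {f : ℝ → X} {g : X → Y} {a b : ℝ} {K : NNReal}
    {s : Set X} (hf : AbsolutelyContinuousOnInterval f a b) (hg : LipschitzOnWith K g s)
    (hs : MapsTo f (uIcc a b) s) : AbsolutelyContinuousOnInterval (g ∘ f) a b := by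
  rw [absolutelyContinuousOnInterval_iff] at hf ⊢
  intro ε hε
  obtain ⟨δ, hδ, h⟩ := hf (ε / (K + 1)) (by positivity)
  refine ⟨δ, hδ, fun J hJ hJδ => ?_⟩
  calc ∑ i ∈ Finset.range J.1, dist (g (f (J.2 i).1)) (g (f (J.2 i).2))
      ≤ ∑ i ∈ Finset.range J.1, (K + 1 : ℝ) * dist (f (J.2 i).1) (f (J.2 i).2) := by
        refine Finset.sum_le_sum fun i hi => ?_
        refine (hg.dist_le_mul _ (hs (hJ.1 i hi).1) _ (hs (hJ.1 i hi).2)).trans ?_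
        gcongr
        simp
    _ = (K + 1 : ℝ) * ∑ i ∈ Finset.range J.1, dist (f (J.2 i).1) (f (J.2 i).2) := by
        rw [Finset.mul_sum]
    _ < (K + 1 : ℝ) * (ε / (K + 1)) := by
        gcongr
        exact h J hJ hJδ
    _ = ε := by field_simp

/-! ### Integration on the unit interval -/

lemma zero_mem_I : (0 : ℝ) ∈ Icc (0 : ℝ) 1 := ⟨le_rfl, zero_le_one⟩

lemma one_mem_I : (1 : ℝ) ∈ Icc (0 : ℝ) 1 := ⟨zero_le_one, le_rfl⟩

lemma intervalIntegral_eq_integral_μI (f : ℝ → ℝ) : ∫ x in (0 : ℝ)..1, f x = ∫ x, f x ∂μI := by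
  rw [intervalIntegral.integral_of_le zero_le_one, integral_Icc_eq_integral_Ioc]

lemma intervalIntegrable_of_integrable_μI {f : ℝ → ℝ} (hf : Integrable f μI) {a b : ℝ}
    (ha : a ∈ Icc (0 : ℝ) 1) (hb : b ∈ Icc (0 : ℝ) 1) : IntervalIntegrable f volume a b := by
  rw [intervalIntegrable_iff]
  refine IntegrableOn.mono_set (t := Icc 0 1) hf ?_
  exact uIoc_subset_uIcc.trans (Icc_subset_Icc (le_inf ha.1 hb.1) (sup_le ha.2 hb.2))

lemma intervalIntegral_congr_ae_μI {f g : ℝ → ℝ} (h : f =ᵐ[μI] g) {a b : ℝ}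
    (ha : a ∈ Icc (0 : ℝ) 1) (hb : b ∈ Icc (0 : ℝ) 1) : ∫ x in a..b, f x = ∫ x in a..b, g x := by
  refine intervalIntegral.integral_congr_ae ?_
  rw [EventuallyEq, ae_restrict_iff' measurableSet_Icc] at h
  filter_upwards [h] with x hx hx'
  exact hx (uIoc_subset_uIcc.trans (Icc_subset_Icc (le_inf ha.1 hb.1) (sup_le ha.2 hb.2)) hx')

lemma integrable_L2 (u : L2) : Integrable u μI :=
  (Lp.memLp u).integrable (by norm_num)

lemma integrable_mul_L2 (u v : L2) : Integrable (fun x => u x * v x) μI :=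
  MemLp.integrable_mul (Lp.memLp u) (Lp.memLp v)

lemma inner_L2_eq_integral (u v : L2) : inner ℝ u v = ∫ x in (0 : ℝ)..1, u x * v x := by
  rw [L2.inner_def, intervalIntegral_eq_integral_μI]
  simp only [RCLike.inner_apply, conj_trivial, mul_comm]

/-! ### Continuous functions acting on square integrable functions -/

/-- The Banach algebra `C([0,1])`. -/
abbrev CI : Type := C(Icc (0 : ℝ) 1, ℝ)

/-- The extension of `g ∈ C([0,1])` to the line that is constant on either side of `[0,1]`; it is
used to integrate `g`. -/
def extI (g : CI) : ℝ → ℝ := IccExtend zero_le_one g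

lemma continuous_extI (g : CI) : Continuous (extI g) := g.continuous.Icc_extend'

lemma extI_of_mem (g : CI) {x : ℝ} (hx : x ∈ Icc (0 : ℝ) 1) : extI g x = g ⟨x, hx⟩ :=
  IccExtend_of_mem _ _ hx

lemma norm_extI_le (g : CI) (x : ℝ) : ‖extI g x‖ ≤ ‖g‖ := g.norm_coe_le_norm _

lemma extI_mul (g h : CI) (x : ℝ) : extI (g * h) x = extI g x * extI h x := rfl

lemma memLp_top_extI (g : CI) : MemLp (extI g) ⊤ μI :=
  memLp_top_of_bound (continuous_extI g).aestronglyMeasurable ‖g‖ (.of_forall (norm_extI_le g))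

/-- The inclusion of `C([0,1])` in `L^∞([0,1])`. -/
def toLinfty : CI →L[ℝ] Lp ℝ ⊤ μI :=
  LinearMap.mkContinuous
    { toFun := fun g => (memLp_top_extI g).toLp
      map_add' := fun g h => MemLp.toLp_add (memLp_top_extI g) (memLp_top_extI h)
      map_smul' := fun c g => MemLp.toLp_const_smul c (memLp_top_extI g) } 1
    (fun g => by
      refine (Lp.norm_le_of_ae_bound (norm_nonneg g) ?_).trans_eq (by simp)
      filter_upwards [(memLp_top_extI g).coeFn_toLp] with x hx
      exact hx ▸ norm_extI_le g x)

lemma coeFn_toLinfty (g : CI) : toLinfty g =ᵐ[μI] extI g := (memLp_top_extI g).coeFn_toLp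

/-- The multiplication of square integrable functions by continuous functions. -/
def mulL2 : CI →L[ℝ] L2 →L[ℝ] L2 :=
  (ContinuousLinearMap.mul ℝ ℝ).holderL μI ⊤ 2 2 ∘L toLinfty

lemma coeFn_mulL2 (g : CI) (u : L2) : mulL2 g u =ᵐ[μI] fun x => extI g x * u x := by
  filter_upwards [(ContinuousLinearMap.mul ℝ ℝ).coeFn_holder (r := 2) (toLinfty g) u,
    coeFn_toLinfty g] with x hx hg
  exact hx.trans (by rw [hg, ContinuousLinearMap.mul_apply'])

attribute [irreducible] mulL2

lemma mulL2_mulL2 (g h : CI) (u : L2) : mulL2 g (mulL2 h u) = mulL2 (g * h) u := by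
  refine Lp.ext ?_
  filter_upwards [coeFn_mulL2 g (mulL2 h u), coeFn_mulL2 h u, coeFn_mulL2 (g * h) u]
    with x h1 h2 h3
  rw [h1, h2, h3, extI_mul, mul_assoc]

lemma one_mulL2 (u : L2) : mulL2 1 u = u := by
  refine Lp.ext ?_
  filter_upwards [coeFn_mulL2 1 u] with x hx
  exact hx.trans (one_mul _)

lemma inner_mulL2_left (g : CI) (u v : L2) : inner ℝ (mulL2 g u) v = inner ℝ u (mulL2 g v) := by
  rw [inner_L2_eq_integral, inner_L2_eq_integral]
  refine intervalIntegral_congr_ae_μI ?_ zero_mem_I one_mem_I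
  filter_upwards [coeFn_mulL2 g u, coeFn_mulL2 g v] with x h1 h2
  rw [h1, h2]; ring

/-- The constant function `1`. -/
def oneL2 : L2 := (memLp_const (1 : ℝ)).toLp _

lemma coeFn_oneL2 : oneL2 =ᵐ[μI] fun _ => (1 : ℝ) := MemLp.coeFn_toLp _

/-- The inclusion of `C([0,1])` in `L²([0,1])`. -/
def toL2 : CI →L[ℝ] L2 := mulL2.flip oneL2

lemma coeFn_toL2 (g : CI) : toL2 g =ᵐ[μI] extI g := by
  filter_upwards [coeFn_mulL2 g oneL2, coeFn_oneL2] with x h1 h2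
  exact h1.trans (by rw [h2, mul_one])

lemma toL2_one : toL2 1 = oneL2 := one_mulL2 oneL2

lemma mulL2_toL2 (g h : CI) : mulL2 g (toL2 h) = toL2 (g * h) := mulL2_mulL2 g h oneL2

lemma inner_toL2_mul (g h : CI) (u : L2) :
    inner ℝ (toL2 (g * h)) u = inner ℝ (toL2 g) (mulL2 h u) := by
  rw [mul_comm, ← mulL2_toL2, inner_mulL2_left]

/-! ### Primitives -/

lemma continuousOn_primitive_μI {f : ℝ → ℝ} (hf : Integrable f μI) :
    ContinuousOn (fun x => ∫ y in (0 : ℝ)..x, f y) (Icc 0 1) := by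
  have := intervalIntegral.continuousOn_primitive_interval (μ := volume) (f := f) (a := 0) (b := 1)
    (by rw [uIcc_of_le zero_le_one]; exact hf)
  rwa [uIcc_of_le zero_le_one] at this

/-- The primitive `x ↦ ∫₀ˣ f` of an integrable function, as a continuous function on `[0,1]`. -/
def primL1 : Lp ℝ 1 μI →L[ℝ] CI :=
  LinearMap.mkContinuous
    { toFun := fun f => ⟨fun x => ∫ y in (0 : ℝ)..x, f y,
        (continuousOn_primitive_μI (L1.integrable_coeFn f)).domRestrict⟩
      map_add' := fun f g => by
        ext x
        have h (f : Lp ℝ 1 μI) := intervalIntegrable_of_integrable_μI (L1.integrable_coeFn f)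
          zero_mem_I x.2
        exact (intervalIntegral_congr_ae_μI (Lp.coeFn_add f g) zero_mem_I x.2).trans
          (intervalIntegral.integral_add (h f) (h g))
      map_smul' := fun c f => by
        ext x
        exact (intervalIntegral_congr_ae_μI (Lp.coeFn_smul c f) zero_mem_I x.2).trans
          (intervalIntegral.integral_smul c f) } 1
    (fun f => by
      rw [one_mul, L1.norm_eq_integral_norm]
      refine (ContinuousMap.norm_le _ (by positivity)).2 fun x => ?_
      calc ‖∫ y in (0 : ℝ)..x, f y‖ ≤ ∫ y in Ioc (0 : ℝ) x, ‖f y‖ := by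
            rw [intervalIntegral.integral_of_le x.2.1]
            exact norm_integral_le_integral_norm _
        _ ≤ ∫ y, ‖f y‖ ∂μI :=
            setIntegral_mono_set (L1.integrable_coeFn f).norm (.of_forall fun _ => norm_nonneg _)
              (Ioc_subset_Icc_self.trans (Icc_subset_Icc_right x.2.2)).eventuallyLE)

/-- The bilinear map sending `u, v ∈ L²([0,1])` to the primitive `x ↦ ∫₀ˣ u v`. -/
def primMul : L2 →L[ℝ] L2 →L[ℝ] CI :=
  (ContinuousLinearMap.compL ℝ L2 (Lp ℝ 1 μI) CI primL1) ∘L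
    (ContinuousLinearMap.mul ℝ ℝ).holderL μI 2 2 1

lemma primMul_apply (u v : L2) (x : Icc (0 : ℝ) 1) :
    primMul u v x = ∫ y in (0 : ℝ)..x, u y * v y :=
  intervalIntegral_congr_ae_μI ((ContinuousLinearMap.mul ℝ ℝ).coeFn_holder (r := 1) u v)
    zero_mem_I x.2

attribute [irreducible] primMul

/-- The primitive `x ↦ ∫₀ˣ u` of `u ∈ L²([0,1])`. -/
def prim : L2 →L[ℝ] CI := primMul oneL2

lemma prim_apply (u : L2) (x : Icc (0 : ℝ) 1) : prim u x = ∫ y in (0 : ℝ)..x, u y := by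
  refine (primMul_apply oneL2 u x).trans (intervalIntegral_congr_ae_μI ?_ zero_mem_I x.2)
  filter_upwards [coeFn_oneL2] with y hy
  rw [hy, one_mul]

lemma extI_prim (u : L2) {x : ℝ} (hx : x ∈ Icc (0 : ℝ) 1) :
    extI (prim u) x = ∫ y in (0 : ℝ)..x, u y := by
  rw [extI_of_mem _ hx, prim_apply]

lemma extI_primMul (u v : L2) {x : ℝ} (hx : x ∈ Icc (0 : ℝ) 1) :
    extI (primMul u v) x = ∫ y in (0 : ℝ)..x, u y * v y := by
  rw [extI_of_mem _ hx, primMul_apply]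

/-- The right end of the unit interval. -/
def oneI : Icc (0 : ℝ) 1 := ⟨1, one_mem_I⟩

lemma primMul_oneI (u v : L2) : primMul u v oneI = inner ℝ u v := by
  rw [primMul_apply, inner_L2_eq_integral, oneI]

lemma prim_oneI (u : L2) : prim u oneI = inner ℝ oneL2 u := primMul_oneI _ _

lemma primMul_mulL2 (g : CI) (u v : L2) : primMul (mulL2 g u) v = primMul u (mulL2 g v) := by
  ext x
  rw [primMul_apply, primMul_apply]
  refine intervalIntegral_congr_ae_μI ?_ zero_mem_I x.2
  filter_upwards [coeFn_mulL2 g u, coeFn_mulL2 g v] with y h1 h2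
  rw [h1, h2]; ring

lemma primMul_comm (u v : L2) : primMul u v = primMul v u := by
  ext x
  simp only [primMul_apply, mul_comm]

lemma primMul_toL2 (g : CI) (u : L2) : primMul (toL2 g) u = prim (mulL2 g u) :=
  primMul_mulL2 g oneL2 u

/-! ### Integration by parts -/

lemma absolutelyContinuousOnInterval_primitive {u : ℝ → ℝ} (hu : Integrable u μI) :
    AbsolutelyContinuousOnInterval (fun x => ∫ y in (0 : ℝ)..x, u y) 0 1 :=
  (intervalIntegrable_of_integrable_μI hu zero_mem_I
    one_mem_I).absolutelyContinuousOnInterval_intervalIntegral left_mem_uIcc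

lemma ae_hasDerivAt_primitive {u : ℝ → ℝ} (hu : Integrable u μI) :
    ∀ᵐ x ∂μI, HasDerivAt (fun x => ∫ y in (0 : ℝ)..x, u y) (u x) x := by
  rw [ae_restrict_iff' measurableSet_Icc]
  filter_upwards [(intervalIntegrable_of_integrable_μI hu zero_mem_I
    one_mem_I).ae_hasDerivAt_integral] with x hx hx'
  rw [uIcc_of_le zero_le_one] at hx
  exact hx hx' 0 zero_mem_I

lemma integral_primitive_mul {u v : ℝ → ℝ} (hu : Integrable u μI) (hv : Integrable v μI)
    {z : ℝ} (hz : z ∈ Icc (0 : ℝ) 1) :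
    ∫ x in (0 : ℝ)..z, (∫ y in (0 : ℝ)..x, u y) * v x =
      (∫ x in (0 : ℝ)..z, u x) * (∫ x in (0 : ℝ)..z, v x) -
        ∫ x in (0 : ℝ)..z, u x * ∫ y in (0 : ℝ)..x, v y := by
  have hsub : uIcc 0 z ⊆ uIcc (0 : ℝ) 1 := by
    rw [uIcc_of_le hz.1, uIcc_of_le zero_le_one]
    exact Icc_subset_Icc_right hz.2
  have hac {f : ℝ → ℝ} (hf : Integrable f μI) :=
    (absolutelyContinuousOnInterval_primitive hf).mono hsub
  have h := (hac hu).integral_mul_deriv_eq_deriv_mul (hac hv)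
  have hleft : ∫ x in (0 : ℝ)..z, (∫ y in (0 : ℝ)..x, u y) *
      deriv (fun x => ∫ y in (0 : ℝ)..x, v y) x =
      ∫ x in (0 : ℝ)..z, (∫ y in (0 : ℝ)..x, u y) * v x := by
    refine intervalIntegral_congr_ae_μI ?_ zero_mem_I hz
    filter_upwards [ae_hasDerivAt_primitive hv] with x hx
    rw [hx.deriv]
  have hright : ∫ x in (0 : ℝ)..z, deriv (fun x => ∫ y in (0 : ℝ)..x, u y) x *
      (∫ y in (0 : ℝ)..x, v y) =
      ∫ x in (0 : ℝ)..z, u x * ∫ y in (0 : ℝ)..x, v y := by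
    refine intervalIntegral_congr_ae_μI ?_ zero_mem_I hz
    filter_upwards [ae_hasDerivAt_primitive hu] with x hx
    rw [hx.deriv]
  rw [hleft, hright] at h
  simpa only [intervalIntegral.integral_same, zero_mul, mul_zero, sub_zero] using h

lemma primMul_toL2_primMul (u v w : L2) :
    primMul (toL2 (primMul u v)) w = primMul u v * prim w - primMul (mulL2 (prim w) u) v := by
  ext x
  have hparts := integral_primitive_mul (integrable_mul_L2 u v) (integrable_L2 w) x.2
  rw [ContinuousMap.sub_apply, ContinuousMap.mul_apply, prim_apply, primMul_apply u v,
    primMul_apply, primMul_apply]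
  have hleft : ∫ y in (0 : ℝ)..x, toL2 (primMul u v) y * w y =
      ∫ y in (0 : ℝ)..x, (∫ z in (0 : ℝ)..y, u z * v z) * w y := by
    refine intervalIntegral_congr_ae_μI ?_ zero_mem_I x.2
    filter_upwards [coeFn_toL2 (primMul u v), ae_restrict_mem measurableSet_Icc] with y hy hy'
    rw [hy, extI_primMul _ _ hy']
  have hright : ∫ y in (0 : ℝ)..x, mulL2 (prim w) u y * v y =
      ∫ y in (0 : ℝ)..x, (u y * v y) * (∫ z in (0 : ℝ)..y, w z) := by
    refine intervalIntegral_congr_ae_μI ?_ zero_mem_I x.2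
    filter_upwards [coeFn_mulL2 (prim w) u, ae_restrict_mem measurableSet_Icc] with y hy hy'
    rw [hy, extI_prim _ hy']; ring
  rw [hleft, hright, hparts]

lemma inner_toL2_primMul (u v w : L2) :
    inner ℝ (toL2 (primMul u v)) w =
      inner ℝ u v * inner ℝ oneL2 w - inner ℝ (mulL2 (prim w) u) v := by
  rw [← primMul_oneI, primMul_toL2_primMul, ContinuousMap.sub_apply, ContinuousMap.mul_apply,
    primMul_oneI, primMul_oneI, prim_oneI]

lemma prim_mul_prim (u v : L2) :
    prim u * prim v = prim (mulL2 (prim u) v) + prim (mulL2 (prim v) u) := by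
  have h := primMul_toL2_primMul oneL2 u v
  rw [← prim, primMul_toL2, primMul_mulL2, ← prim] at h
  rw [h, sub_add_cancel]

/-! ### The functions `η(q)` and `φ(q)` -/

lemma exp_apply_CI (g : CI) (x : Icc (0 : ℝ) 1) : NormedSpace.exp g x = Real.exp (g x) := by
  rw [Real.exp_eq_exp_ℝ]
  exact NormedSpace.map_exp (ContinuousMap.evalAlgHom ℝ ℝ x) (continuous_eval_const x) g

/-- `η(q) ∈ C([0,1])`.  As the exponential of the primitive of `q` in the Banach algebra `C([0,1])`
it is a smooth function of `q`. -/
def etaC (q : L2) : CI := NormedSpace.exp (prim q)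

lemma etaC_apply (q : L2) (x : Icc (0 : ℝ) 1) : etaC q x = eta q x := by
  rw [etaC, exp_apply_CI, prim_apply, eta]

lemma extI_etaC (q : L2) {x : ℝ} (hx : x ∈ Icc (0 : ℝ) 1) : extI (etaC q) x = eta q x := by
  rw [extI_of_mem _ hx, etaC_apply]

lemma eta_pos (q : L2) (x : ℝ) : 0 < eta q x := Real.exp_pos _

lemma etaC_add (u v : L2) : etaC (u + v) = etaC u * etaC v := by
  rw [etaC, map_add, NormedSpace.exp_add, etaC, etaC]

lemma etaC_zero : etaC 0 = 1 := by
  rw [etaC, map_zero, NormedSpace.exp_zero]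

lemma etaC_neg_mul_etaC (q : L2) : etaC (-q) * etaC q = 1 := by
  rw [← etaC_add, neg_add_cancel, etaC_zero]

lemma etaC_mul_etaC_neg (q : L2) : etaC q * etaC (-q) = 1 := by
  rw [mul_comm, etaC_neg_mul_etaC]

lemma mulL2_etaC_neg_mulL2_etaC (q r : L2) : mulL2 (etaC (-q)) (mulL2 (etaC q) r) = r := by
  rw [mulL2_mulL2, etaC_neg_mul_etaC, one_mulL2]

lemma mulL2_etaC_mulL2_etaC_neg (q r : L2) : mulL2 (etaC q) (mulL2 (etaC (-q)) r) = r := by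
  rw [mulL2_mulL2, etaC_mul_etaC_neg, one_mulL2]

lemma extI_etaC_neg (q : L2) {x : ℝ} (hx : x ∈ Icc (0 : ℝ) 1) :
    extI (etaC (-q)) x = (eta q x)⁻¹ := by
  refine eq_inv_of_mul_eq_one_right ?_
  rw [extI_of_mem _ hx, ← etaC_apply q ⟨x, hx⟩, ← ContinuousMap.mul_apply, etaC_mul_etaC_neg,
    ContinuousMap.one_apply]

lemma coeFn_mulL2_etaC (q p : L2) : mulL2 (etaC q) p =ᵐ[μI] fun x => eta q x * p x := by
  filter_upwards [coeFn_mulL2 (etaC q) p, ae_restrict_mem measurableSet_Icc] with x hx hxI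
  rw [hx, extI_etaC q hxI]

lemma eq_zero_of_inner_mulL2_etaC {q r : L2} (h : inner ℝ (mulL2 (etaC q) r) r = 0) : r = 0 := by
  have hsqrt : etaC q = etaC ((1 / 2 : ℝ) • q) * etaC ((1 / 2 : ℝ) • q) := by
    rw [← etaC_add, ← add_smul]; norm_num
  rw [hsqrt, ← mulL2_mulL2, inner_mulL2_left, inner_self_eq_zero] at h
  rw [← mulL2_etaC_neg_mulL2_etaC ((1 / 2 : ℝ) • q) r, h, map_zero]

/-- `φ(q) ∈ C([0,1])`, the primitive of `η(q)`. -/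
def phiC (q : L2) : CI := prim (toL2 (etaC q))

lemma phiC_apply (q : L2) (x : Icc (0 : ℝ) 1) : phiC q x = phi q x := by
  rw [phiC, prim_apply, phi]
  refine intervalIntegral_congr_ae_μI ?_ zero_mem_I x.2
  filter_upwards [coeFn_toL2 (etaC q), ae_restrict_mem measurableSet_Icc] with y hy hyI
  rw [hy, extI_etaC q hyI]

lemma extI_phiC (q : L2) {x : ℝ} (hx : x ∈ Icc (0 : ℝ) 1) : extI (phiC q) x = phi q x := by
  rw [extI_of_mem _ hx, phiC_apply]

lemma phiC_oneI {q : L2} (hq : q ∈ Q) : phiC q oneI = 1 := by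
  rw [phiC_apply]; exact hq.2

lemma mem_Q_iff {q : L2} :
    q ∈ Q ↔ inner ℝ oneL2 q = 0 ∧ inner ℝ oneL2 (toL2 (etaC q)) = 1 := by
  rw [← prim_oneI, ← prim_oneI, ← phiC, prim_apply, phiC_apply]
  rfl

lemma metricQ_eq (q X Y : L2) : metricQ q X Y = inner ℝ (mulL2 (etaC (-q)) X) Y := by
  rw [inner_L2_eq_integral, metricQ]
  refine intervalIntegral_congr_ae_μI ?_ zero_mem_I one_mem_I
  filter_upwards [coeFn_mulL2 (etaC (-q)) X, ae_restrict_mem measurableSet_Icc] with x hx hxI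
  rw [hx, extI_etaC_neg q hxI, div_eq_inv_mul, mul_assoc]

lemma hamiltonian_eq (z : L2 × L2) :
    hamiltonian z = (1 / 2) * inner ℝ (mulL2 (etaC z.1) z.2) z.2 := by
  rw [inner_L2_eq_integral, hamiltonian]
  congr 1
  refine intervalIntegral_congr_ae_μI ?_ zero_mem_I one_mem_I
  filter_upwards [coeFn_mulL2_etaC z.1 z.2] with x hx
  rw [hx]; ring

lemma contDiff_etaC {n : WithTop ℕ∞} : ContDiff ℝ n etaC := by
  have hexp : ContDiff ℝ n (NormedSpace.exp : CI → CI) :=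
    AnalyticOnNhd.contDiff fun x _ => NormedSpace.exp_analytic x
  exact hexp.comp prim.contDiff

lemma hasFDerivAt_etaC (q : L2) :
    HasFDerivAt etaC (ContinuousLinearMap.mul ℝ CI (etaC q) ∘L prim) q := by
  refine ((hasFDerivAt_exp (𝕂 := ℝ)).comp q prim.hasFDerivAt).congr_fderiv ?_
  ext v : 1
  rfl

lemma contDiff_phiC {n : WithTop ℕ∞} : ContDiff ℝ n phiC :=
  prim.contDiff.comp (toL2.contDiff.comp contDiff_etaC)

lemma hasFDerivAt_phiC (q : L2) : HasFDerivAt phiC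
    ((prim ∘L toL2) ∘L (ContinuousLinearMap.mul ℝ CI (etaC q) ∘L prim)) q :=
  (prim ∘L toL2).hasFDerivAt.comp q (hasFDerivAt_etaC q)

attribute [irreducible] etaC

/-! ### Change of variables by `φ(q)` -/

lemma hasDerivWithinAt_phi (q : L2) {x : ℝ} (hx : x ∈ Icc (0 : ℝ) 1) :
    HasDerivWithinAt (phi q) (eta q x) (Icc 0 1) x := by
  have hderiv := ((continuous_extI (etaC q)).integral_hasStrictDerivAt 0 x).hasDerivAt
  have hphi : ∀ z ∈ Icc (0 : ℝ) 1, phi q z = ∫ y in (0 : ℝ)..z, extI (etaC q) y := by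
    intro z hz
    refine intervalIntegral_congr_ae_μI ?_ zero_mem_I hz
    filter_upwards [ae_restrict_mem measurableSet_Icc] with y hy
    rw [extI_etaC q hy]
  rw [← extI_etaC q hx]
  exact hderiv.hasDerivWithinAt.congr hphi (hphi x hx)

lemma continuousOn_phi (q : L2) : ContinuousOn (phi q) (Icc 0 1) :=
  fun _ hx => (hasDerivWithinAt_phi q hx).continuousWithinAt

lemma strictMonoOn_phi (q : L2) : StrictMonoOn (phi q) (Icc 0 1) := by
  refine strictMonoOn_of_deriv_pos (convex_Icc 0 1) (continuousOn_phi q) fun x hx => ?_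
  rw [interior_Icc] at hx
  rw [((hasDerivWithinAt_phi q (Ioo_subset_Icc_self hx)).hasDerivAt
    (Icc_mem_nhds hx.1 hx.2)).deriv]
  exact eta_pos q x

lemma phi_zero (q : L2) : phi q 0 = 0 := intervalIntegral.integral_same

lemma phiInv_phi (q : L2) {x : ℝ} (hx : x ∈ Icc (0 : ℝ) 1) : phiInv q (phi q x) = x :=
  (strictMonoOn_phi q).injOn.leftInvOn_invFunOn hx

lemma phi_nonneg (q : L2) {x : ℝ} (hx : x ∈ Icc (0 : ℝ) 1) : 0 ≤ phi q x :=
  (phi_zero q).symm.trans_le ((strictMonoOn_phi q).monotoneOn zero_mem_I hx hx.1)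

lemma phi_image_Icc (q : L2) {z : ℝ} (hz : z ∈ Icc (0 : ℝ) 1) :
    phi q '' Icc 0 z = Icc 0 (phi q z) := by
  have hsub : Icc 0 z ⊆ Icc (0 : ℝ) 1 := Icc_subset_Icc_right hz.2
  refine Subset.antisymm ?_ ?_
  · rintro _ ⟨y, hy, rfl⟩
    exact ⟨phi_nonneg q (hsub hy), (strictMonoOn_phi q).monotoneOn (hsub hy) hz hy.2⟩
  · have := intermediate_value_Icc hz.1 ((continuousOn_phi q).mono hsub)
    rwa [phi_zero] at this

lemma integral_zero_phi (q : L2) {z : ℝ} (hz : z ∈ Icc (0 : ℝ) 1) (g : ℝ → ℝ) :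
    ∫ y in (0 : ℝ)..phi q z, g y = ∫ x in (0 : ℝ)..z, eta q x * g (phi q x) := by
  have hsub : Icc 0 z ⊆ Icc (0 : ℝ) 1 := Icc_subset_Icc_right hz.2
  rw [intervalIntegral.integral_of_le (phi_nonneg q hz), intervalIntegral.integral_of_le hz.1,
    ← integral_Icc_eq_integral_Ioc, ← integral_Icc_eq_integral_Ioc, ← phi_image_Icc q hz,
    integral_image_eq_integral_abs_deriv_smul measurableSet_Icc
      (fun x hx => (hasDerivWithinAt_phi q (hsub hx)).mono hsub)
      ((strictMonoOn_phi q).injOn.mono hsub)]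
  refine setIntegral_congr_fun measurableSet_Icc fun x _ => ?_
  simp only [abs_of_pos (eta_pos q x), smul_eq_mul]

lemma integral_eq_integral_eta_mul_comp_phi {q : L2} (hq : q ∈ Q) (g : ℝ → ℝ) :
    ∫ y in (0 : ℝ)..1, g y = ∫ x in (0 : ℝ)..1, eta q x * g (phi q x) := by
  have := integral_zero_phi q one_mem_I g
  rwa [show phi q 1 = 1 from hq.2] at this

/-! ### Moments -/

lemma inner_toL2_toL2 (g h : CI) : inner ℝ (toL2 g) (toL2 h) = inner ℝ oneL2 (toL2 (g * h)) := by
  rw [← mulL2_toL2, ← inner_mulL2_left, toL2, ContinuousLinearMap.flip_apply]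

lemma inner_oneL2_mulL2 (g : CI) (u : L2) : inner ℝ oneL2 (mulL2 g u) = inner ℝ (toL2 g) u := by
  rw [← inner_mulL2_left, toL2, ContinuousLinearMap.flip_apply]

lemma inner_toL2_prim (u v : L2) : inner ℝ (toL2 (prim u)) v =
    inner ℝ oneL2 u * inner ℝ oneL2 v - inner ℝ u (toL2 (prim v)) := by
  rw [prim, inner_toL2_primMul, real_inner_comm (toL2 _) u]
  rfl

lemma smul_prim_etaC_mul_phiC_pow (q : L2) (k : ℕ) :
    (k + 1 : ℝ) • prim (toL2 (etaC q * phiC q ^ k)) = phiC q ^ (k + 1) := by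
  induction k with
  | zero => simp [phiC]
  | succ k ih =>
    have hparts := prim_mul_prim (toL2 (etaC q * phiC q ^ k)) (toL2 (etaC q))
    rw [← phiC, mulL2_toL2, mulL2_toL2] at hparts
    calc ((k + 1 : ℕ) + 1 : ℝ) • prim (toL2 (etaC q * phiC q ^ (k + 1)))
        = prim (toL2 (((k + 1 : ℝ) • prim (toL2 (etaC q * phiC q ^ k))) * etaC q)) +
            (k + 1 : ℝ) • prim (toL2 (phiC q * (etaC q * phiC q ^ k))) := by
          rw [ih, mul_left_comm, ← pow_succ', mul_comm (phiC q ^ (k + 1)), add_smul, one_smul,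
            Nat.cast_succ, add_comm]
      _ = ((k + 1 : ℝ) • prim (toL2 (etaC q * phiC q ^ k))) * phiC q := by
          rw [smul_mul_assoc, smul_mul_assoc, map_smul, map_smul, ← smul_add, ← hparts]
      _ = phiC q ^ (k + 1 + 1) := by rw [ih, ← pow_succ]

/-- The function `η(q) φ(q)ᵏ`. -/
def momentWeight (k : ℕ) (q : L2) : CI := etaC q * phiC q ^ k

/-- The moment `∫₀¹ η(q) φ(q)ᵏ p`; those of orders `0` and `1` are the constraints on the covectors
`p` at `q`. -/
def moment (k : ℕ) (q p : L2) : ℝ := inner ℝ (toL2 (momentWeight k q)) p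

lemma extI_momentWeight (k : ℕ) (q : L2) {x : ℝ} (hx : x ∈ Icc (0 : ℝ) 1) :
    extI (momentWeight k q) x = eta q x * phi q x ^ k := by
  rw [momentWeight, extI_mul, extI_etaC q hx, ← extI_phiC q hx]
  rfl

lemma moment_eq_integral (k : ℕ) (q p : L2) :
    moment k q p = ∫ x in (0 : ℝ)..1, eta q x * phi q x ^ k * p x := by
  rw [moment, inner_L2_eq_integral]
  refine intervalIntegral_congr_ae_μI ?_ zero_mem_I one_mem_I
  filter_upwards [coeFn_toL2 (momentWeight k q), ae_restrict_mem measurableSet_Icc] with x hx hxI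
  rw [hx, extI_momentWeight k q hxI]

lemma mem_cotangentQ_iff {q p : L2} :
    (q, p) ∈ cotangentQ ↔ q ∈ Q ∧ ∀ k : Fin 2, moment k q p = 0 := by
  simp only [cotangentQ, mem_ofPred_eq, Fin.forall_fin_two, moment_eq_integral, Fin.val_zero,
    Fin.val_one, pow_zero, pow_one, mul_one, mul_right_comm]

lemma moment_eq_inner_mulL2 (k : ℕ) (q p : L2) :
    moment k q p = inner ℝ (toL2 (phiC q ^ k)) (mulL2 (etaC q) p) := by
  rw [moment, momentWeight, mul_comm, inner_toL2_mul]

lemma moment_toL2_phiC_pow {q : L2} (hq : q ∈ Q) (k j : ℕ) :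
    moment k q (toL2 (phiC q ^ j)) = 1 / (k + j + 1) := by
  have hprim := congrArg (· oneI) (smul_prim_etaC_mul_phiC_pow q (k + j))
  simp only [ContinuousMap.smul_apply, ContinuousMap.pow_apply, phiC_oneI hq, one_pow, prim_oneI,
    smul_eq_mul, Nat.cast_add] at hprim
  rw [moment, momentWeight, inner_toL2_toL2, mul_assoc, ← pow_add, eq_div_iff (by positivity),
    mul_comm, hprim]

/-! ### The Hamiltonian vector field -/

/-- The combination of `1` and `φ(q)` which, for `q ∈ Q`, has moments `c 0` and `c 1`: the Hilbert
matrix is the Gram matrix of `1` and `φ(q)` for the weight `η(q)`. -/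
def multiplier (q : L2) (c : Fin 2 → ℝ) : CI :=
  ∑ j : Fin 2, (hilbertMatrix⁻¹.mulVec c) j • phiC q ^ (j : ℕ)

lemma hilbertMatrix_apply (i j : Fin 2) : hilbertMatrix i j = 1 / (i + j + 1) := by
  fin_cases i <;> fin_cases j <;> norm_num [hilbertMatrix]

lemma moment_toL2_multiplier {q : L2} (hq : q ∈ Q) (c : Fin 2 → ℝ) (k : Fin 2) :
    moment k q (toL2 (multiplier q c)) = c k := by
  have hdet : IsUnit hilbertMatrix.det := by norm_num [hilbertMatrix, Matrix.det_fin_two]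
  calc moment k q (toL2 (multiplier q c))
      = ∑ j : Fin 2, (hilbertMatrix⁻¹.mulVec c) j * moment k q (toL2 (phiC q ^ (j : ℕ))) := by
        simp only [moment, multiplier, map_sum, map_smul, inner_sum, real_inner_smul_right]
    _ = hilbertMatrix.mulVec (hilbertMatrix⁻¹.mulVec c) k := by
        simp only [moment_toL2_phiC_pow hq, ← hilbertMatrix_apply, Matrix.mulVec, dotProduct,
          mul_comm]
    _ = c k := by rw [Matrix.mulVec_mulVec, Matrix.mul_nonsing_inv _ hdet, Matrix.one_mulVec]

/-- The function `x ↦ ∫ₓ¹ η(q) p²`. -/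
def tailC (q p : L2) : CI :=
  inner ℝ (mulL2 (etaC q) p) p • (1 : CI) - primMul (mulL2 (etaC q) p) p

lemma extI_tailC (q p : L2) {x : ℝ} (hx : x ∈ Icc (0 : ℝ) 1) :
    extI (tailC q p) x = ∫ y in x..1, eta q y * p y ^ 2 := by
  have hintegral := integrable_mul_L2 (mulL2 (etaC q) p) p
  rw [extI_of_mem _ hx, tailC, ContinuousMap.sub_apply, ContinuousMap.smul_apply,
    ContinuousMap.one_apply, smul_eq_mul, mul_one, primMul_apply, inner_L2_eq_integral,
    intervalIntegral.integral_interval_sub_left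
      (intervalIntegrable_of_integrable_μI hintegral zero_mem_I one_mem_I)
      (intervalIntegrable_of_integrable_μI hintegral zero_mem_I hx)]
  refine intervalIntegral_congr_ae_μI ?_ hx one_mem_I
  filter_upwards [coeFn_mulL2_etaC q p] with y hy
  rw [hy]; ring

lemma inner_toL2_tailC (q p v : L2) :
    inner ℝ (toL2 (tailC q p)) v = inner ℝ (mulL2 (etaC q * prim v) p) p := by
  rw [tailC, map_sub, map_smul, inner_sub_left, real_inner_smul_left, inner_toL2_primMul, toL2_one,
    mulL2_mulL2, mul_comm (prim v), sub_sub_cancel]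

lemma moment_toL2_tailC (k : ℕ) (q p : L2) : (k + 1) * moment k q (toL2 (tailC q p)) =
    inner ℝ (mulL2 (momentWeight (k + 1) q) p) p := by
  rw [moment, real_inner_comm, inner_toL2_tailC, ← real_inner_smul_left, momentWeight, momentWeight,
    ← smul_prim_etaC_mul_phiC_pow, mul_smul_comm, map_smul, smul_apply]

lemma integral_pow_mul_comp_phiInv_sq {q : L2} (hq : q ∈ Q) (k : ℕ) (p : L2) :
    ∫ x in (0 : ℝ)..1, x ^ k * p (phiInv q x) ^ 2 =
      inner ℝ (mulL2 (momentWeight k q) p) p := by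
  rw [integral_eq_integral_eta_mul_comp_phi hq, inner_L2_eq_integral]
  refine intervalIntegral_congr_ae_μI ?_ zero_mem_I one_mem_I
  filter_upwards [coeFn_mulL2 (momentWeight k q) p, ae_restrict_mem measurableSet_Icc] with x hx hxI
  rw [hx, phiInv_phi q hxI, extI_momentWeight k q hxI]; ring

lemma integral_zero_phi_comp_phiInv (q p : L2) {z : ℝ} (hz : z ∈ Icc (0 : ℝ) 1) :
    ∫ y in (0 : ℝ)..phi q z, p (phiInv q y) = extI (prim (mulL2 (etaC q) p)) z := by
  rw [integral_zero_phi q hz, extI_prim _ hz]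
  refine intervalIntegral_congr_ae_μI ?_ zero_mem_I hz
  filter_upwards [coeFn_mulL2_etaC q p, ae_restrict_mem measurableSet_Icc] with y hy hyI
  rw [hy, phiInv_phi q hyI]

lemma integral_sq_integral_comp_phiInv {q : L2} (hq : q ∈ Q) (p : L2) :
    ∫ x in (0 : ℝ)..1, (∫ y in (0 : ℝ)..x, p (phiInv q y)) ^ 2 =
      moment 0 q (toL2 (prim (mulL2 (etaC q) p) ^ 2)) := by
  rw [integral_eq_integral_eta_mul_comp_phi hq, moment_eq_integral]
  refine intervalIntegral_congr_ae_μI ?_ zero_mem_I one_mem_I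
  filter_upwards [coeFn_toL2 (prim (mulL2 (etaC q) p) ^ 2), ae_restrict_mem measurableSet_Icc]
    with x hx hxI
  rw [hx, integral_zero_phi_comp_phiInv q p hxI, pow_zero, mul_one, sq (prim _), extI_mul, sq]

/-- The vector `[a; b + c]` of the system, written as integrals over `[0,1]` without `φ(q)⁻¹`. -/
def momentumCoef (q p : L2) : Fin 2 → ℝ :=
  ![(1 / 2) * inner ℝ (mulL2 (momentWeight 1 q) p) p,
    (3 / 2) * moment 0 q (toL2 (prim (mulL2 (etaC q) p) ^ 2)) +
      (1 / 4) * inner ℝ (mulL2 (momentWeight 2 q) p) p]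

lemma momentumCoef_eq {q : L2} (hq : q ∈ Q) (p : L2) :
    momentumCoef q p = ![coefA q p, coefB q p + coefC q p] := by
  rw [momentumCoef, ← integral_pow_mul_comp_phiInv_sq hq, ← integral_pow_mul_comp_phiInv_sq hq,
    ← integral_sq_integral_comp_phiInv hq, coefA, coefB, coefC]
  simp only [pow_one]

/-- The right-hand side of the equation for `ṗ`, as a continuous function on `[0,1]`. -/
def momentumC (q p : L2) : CI :=
  (-(1 / 2) : ℝ) • tailC q p + multiplier q (momentumCoef q p)

lemma extI_momentumC {q : L2} (hq : q ∈ Q) (p : L2) {x : ℝ} (hx : x ∈ Icc (0 : ℝ) 1) :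
    extI (momentumC q p) x = momentumField q p x := by
  rw [momentumField, ← momentumCoef_eq hq, ← extI_tailC q p hx, ← extI_phiC q hx]
  simp only [extI_of_mem _ hx, momentumC, multiplier, Fin.sum_univ_two, dotProduct,
    ContinuousMap.add_apply, ContinuousMap.smul_apply, ContinuousMap.one_apply, smul_eq_mul,
    Fin.val_zero, Fin.val_one, Matrix.cons_val_zero, Matrix.cons_val_one, pow_zero, pow_one,
    mul_comm]

/-- The vector field on `T*Q` defined by the system. -/
def field (q p : L2) : L2 × L2 := (mulL2 (etaC q) p, toL2 (momentumC q p))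

lemma isFieldAt_iff {q : L2} (hq : q ∈ Q) (p : L2) (X : L2 × L2) :
    IsFieldAt q p X ↔ X = field q p := by
  have hmomentum : toL2 (momentumC q p) =ᵐ[μI] momentumField q p := by
    filter_upwards [coeFn_toL2 (momentumC q p), ae_restrict_mem measurableSet_Icc] with x hx hxI
    rw [hx, extI_momentumC hq p hxI]
  constructor
  · rintro ⟨hfst, hsnd⟩
    exact Prod.ext (Lp.ext (hfst.trans (coeFn_mulL2_etaC q p).symm))
      (Lp.ext (hsnd.trans hmomentum.symm))
  · rintro rfl
    exact ⟨coeFn_mulL2_etaC q p, hmomentum⟩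

lemma continuous_field : Continuous fun z : L2 × L2 => field z.1 z.2 := by
  have hη : Continuous etaC := contDiff_etaC.continuous (n := 0)
  have hφ : Continuous phiC := contDiff_phiC.continuous (n := 0)
  have hcoef (i : Fin 2) : Continuous fun z : L2 × L2 => momentumCoef z.1 z.2 i := by
    fin_cases i <;> simp only [momentumCoef, moment, momentWeight] <;> dsimp <;> fun_prop
  have hcoef' : Continuous fun z : L2 × L2 => momentumCoef z.1 z.2 := continuous_pi hcoef
  unfold field momentumC tailC multiplier
  fun_prop

/-! ### Tangent spaces of `Q` and of its cotangent bundle -/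

/-- The tangent space `T_qQ`, the orthogonal complement of `1` and `φ(q)`. -/
def tangentQ (q : L2) : Submodule ℝ L2 :=
  ⨅ k : Fin 2, (innerSL ℝ (toL2 (phiC q ^ (k : ℕ)))).ker

lemma mem_tangentQ_iff {q h : L2} :
    h ∈ tangentQ q ↔ ∀ k : Fin 2, inner ℝ (toL2 (phiC q ^ (k : ℕ))) h = 0 := by
  simp only [tangentQ, Submodule.mem_iInf, LinearMap.mem_ker, ContinuousLinearMap.coe_coe,
    innerSL_apply_apply]

lemma inner_oneL2_of_mem_tangentQ {q h : L2} (hh : h ∈ tangentQ q) : inner ℝ oneL2 h = 0 := by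
  simpa [toL2_one] using mem_tangentQ_iff.1 hh 0

lemma inner_phiC_of_mem_tangentQ {q h : L2} (hh : h ∈ tangentQ q) :
    inner ℝ (toL2 (phiC q)) h = 0 := by
  simpa using mem_tangentQ_iff.1 hh 1

lemma mulL2_etaC_mem_tangentQ_iff {q r : L2} :
    mulL2 (etaC q) r ∈ tangentQ q ↔ ∀ k : Fin 2, moment k q r = 0 := by
  simp only [mem_tangentQ_iff, moment_eq_inner_mulL2]

lemma inner_multiplier_of_mem_tangentQ {q h : L2} (hh : h ∈ tangentQ q) (c : Fin 2 → ℝ) :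
    inner ℝ (toL2 (multiplier q c)) h = 0 := by
  simp only [multiplier, map_sum, map_smul, sum_inner, real_inner_smul_left,
    mem_tangentQ_iff.1 hh, mul_zero, Finset.sum_const_zero]

lemma contDiff_momentWeight (k : ℕ) {n : WithTop ℕ∞} : ContDiff ℝ n (momentWeight k) :=
  contDiff_etaC.mul (contDiff_phiC.pow k)

lemma fderiv_momentWeight_apply (k : ℕ) (q h : L2) : fderiv ℝ (momentWeight k) q h =
    etaC q * prim h * phiC q ^ k +
      k • (etaC q * phiC q ^ (k - 1) * prim (toL2 (etaC q * prim h))) := by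
  have hder := (hasFDerivAt_etaC q).mul ((hasFDerivAt_phiC q).pow k)
  rw [show momentWeight k = etaC * fun q => phiC q ^ k from rfl, hder.fderiv]
  simp only [nsmul_eq_mul, add_apply, smul_apply, ContinuousLinearMap.comp_apply,
    ContinuousLinearMap.mul_apply', smul_eq_mul]
  ring

lemma contDiff_moment (k : ℕ) {n : WithTop ℕ∞} :
    ContDiff ℝ n fun z : L2 × L2 => moment k z.1 z.2 :=
  (toL2.contDiff.comp ((contDiff_momentWeight k).comp contDiff_fst)).inner ℝ contDiff_snd

/-- The derivative at `z = (q, p)` of the moment `(q, p) ↦ ∫₀¹ η(q) φ(q)ᵏ p`. -/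
def momentDeriv (k : ℕ) (z : L2 × L2) : L2 × L2 →L[ℝ] ℝ := fderiv ℝ (fun z => moment k z.1 z.2) z

lemma hasFDerivAt_moment (k : ℕ) (z : L2 × L2) :
    HasFDerivAt (fun z : L2 × L2 => moment k z.1 z.2) (momentDeriv k z) z :=
  ((contDiff_moment k).differentiable one_ne_zero z).hasFDerivAt

lemma momentDeriv_apply (k : ℕ) (q p : L2) (V : L2 × L2) : momentDeriv k (q, p) V =
    inner ℝ (toL2 (fderiv ℝ (momentWeight k) q V.1)) p + moment k q V.2 := by
  have hweight : HasFDerivAt (momentWeight k) _ q :=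
    ((contDiff_momentWeight k).differentiable one_ne_zero q).hasFDerivAt
  have hder := ((toL2.hasFDerivAt.comp q hweight).comp (q, p) hasFDerivAt_fst).inner ℝ
    (hasFDerivAt_snd (p := (q, p)))
  rw [momentDeriv]
  refine (congrArg (· V) hder.fderiv).trans ?_
  simp [moment, add_comm]

/-- The tangent space of `T*Q` at `(q, p)`, as the kernel of the derivatives of the constraints. -/
def tangentCotangentQ (q p : L2) : Submodule ℝ (L2 × L2) :=
  (tangentQ q).comap (LinearMap.fst ℝ L2 L2) ⊓ ⨅ k : Fin 2, (momentDeriv k (q, p)).ker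

lemma mem_tangentCotangentQ_iff {q p : L2} {V : L2 × L2} :
    V ∈ tangentCotangentQ q p ↔ V.1 ∈ tangentQ q ∧ ∀ k : Fin 2, momentDeriv k (q, p) V = 0 := by
  simp [tangentCotangentQ, Submodule.mem_iInf]

/-! ### The vector field is tangent to the cotangent bundle -/

lemma inner_toL2_prim_self {u : L2} (hu : inner ℝ oneL2 u = 0) :
    inner ℝ (toL2 (prim u)) u = 0 := by
  have hparts := inner_toL2_prim u u
  rw [hu, real_inner_comm (toL2 _) u] at hparts
  linarith

lemma inner_toL2_mul_phiC_prim_self (q : L2) {u : L2} (hu : inner ℝ oneL2 u = 0) :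
    inner ℝ (toL2 (prim u * phiC q)) u = -(1 / 2) * moment 0 q (toL2 (prim u ^ 2)) := by
  have hsq : prim (mulL2 (prim u) u) = (1 / 2 : ℝ) • prim u ^ 2 := by
    rw [sq, prim_mul_prim, ← two_smul ℝ, smul_smul]; norm_num
  rw [mul_comm, inner_toL2_mul, phiC, inner_toL2_prim, inner_oneL2_mulL2, inner_toL2_prim_self hu,
    hsq, map_smul, real_inner_smul_right, moment, momentWeight, pow_zero, mul_one]
  ring

lemma inner_toL2_prim_etaC_mul_prim_self (q : L2) {u : L2} (hu : inner ℝ oneL2 u = 0) :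
    inner ℝ (toL2 (prim (toL2 (etaC q * prim u)))) u = -moment 0 q (toL2 (prim u ^ 2)) := by
  rw [inner_toL2_prim, hu, mul_zero, zero_sub, inner_toL2_mul, mulL2_toL2, ← sq, moment,
    momentWeight, pow_zero, mul_one]

lemma inner_toL2_fderiv_momentWeight_zero {q p : L2}
    (hp : inner ℝ oneL2 (mulL2 (etaC q) p) = 0) :
    inner ℝ (toL2 (fderiv ℝ (momentWeight 0) q (mulL2 (etaC q) p))) p = 0 := by
  rw [fderiv_momentWeight_apply, pow_zero, mul_one, zero_smul, add_zero, mul_comm, inner_toL2_mul,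
    inner_toL2_prim_self hp]

lemma inner_toL2_fderiv_momentWeight_one {q p : L2}
    (hp : inner ℝ oneL2 (mulL2 (etaC q) p) = 0) :
    inner ℝ (toL2 (fderiv ℝ (momentWeight 1) q (mulL2 (etaC q) p))) p =
      -(3 / 2) * moment 0 q (toL2 (prim (mulL2 (etaC q) p) ^ 2)) := by
  rw [fderiv_momentWeight_apply, pow_one, one_smul, Nat.sub_self, pow_zero, mul_one, mul_assoc,
    ← mul_add, mul_comm, inner_toL2_mul, map_add, inner_add_left,
    inner_toL2_mul_phiC_prim_self q hp, inner_toL2_prim_etaC_mul_prim_self q hp]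
  ring

lemma moment_toL2_momentumC {q : L2} (hq : q ∈ Q) (p : L2) (k : Fin 2) :
    moment k q (toL2 (momentumC q p)) =
      momentumCoef q p k - (1 / 2) * moment k q (toL2 (tailC q p)) := by
  rw [← moment_toL2_multiplier hq (momentumCoef q p) k, momentumC, map_add, map_smul]
  simp only [moment, inner_add_right, real_inner_smul_right]
  ring

lemma field_mem_tangentCotangentQ {q p : L2} (h : (q, p) ∈ cotangentQ) :
    field q p ∈ tangentCotangentQ q p := by
  obtain ⟨hq, hp⟩ := mem_cotangentQ_iff.1 h
  have hvelocity : mulL2 (etaC q) p ∈ tangentQ q := mulL2_etaC_mem_tangentQ_iff.2 hp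
  have hone := inner_oneL2_of_mem_tangentQ hvelocity
  have htail (k : ℕ) := moment_toL2_tailC k q p
  refine mem_tangentCotangentQ_iff.2 ⟨hvelocity, fun k => ?_⟩
  rw [momentDeriv_apply, field, moment_toL2_momentumC hq]
  match k with
  | 0 =>
    have := htail 0
    rw [Fin.val_zero, inner_toL2_fderiv_momentWeight_zero hone, momentumCoef, Matrix.cons_val_zero]
    push_cast at this
    linarith
  | 1 =>
    have := htail 1
    rw [Fin.val_one, inner_toL2_fderiv_momentWeight_one hone, momentumCoef, Matrix.cons_val_one,
      Matrix.cons_val_fin_one]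
    push_cast at this
    linarith

/-! ### The symplectic form and the Hamiltonian -/

lemma eq_zero_of_moment_eq_zero_of_orthogonal {q r : L2} (hr : ∀ k : Fin 2, moment k q r = 0)
    (horth : ∀ v ∈ tangentQ q, inner ℝ r v = 0) : r = 0 := by
  have := horth _ (mulL2_etaC_mem_tangentQ_iff.2 hr)
  rw [real_inner_comm] at this
  exact eq_zero_of_inner_mulL2_etaC this

lemma exists_mem_tangentCotangentQ {q h : L2} (p : L2) (hq : q ∈ Q) (hh : h ∈ tangentQ q) :
    ∃ k, (h, k) ∈ tangentCotangentQ q p := by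
  refine ⟨toL2 (multiplier q fun k => -inner ℝ (toL2 (fderiv ℝ (momentWeight k) q h)) p),
    mem_tangentCotangentQ_iff.2 ⟨hh, fun k => ?_⟩⟩
  rw [momentDeriv_apply, moment_toL2_multiplier hq, add_neg_cancel]

lemma zero_prodMk_mem_tangentCotangentQ_iff {q p k : L2} :
    (0, k) ∈ tangentCotangentQ q p ↔ ∀ j : Fin 2, moment j q k = 0 := by
  simp only [mem_tangentCotangentQ_iff, zero_mem, true_and, momentDeriv_apply, map_zero,
    inner_zero_left, zero_add]

lemma symplecticForm_sub_left (V V' W : L2 × L2) :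
    symplecticForm (V - V') W = symplecticForm V W - symplecticForm V' W := by
  simp only [symplecticForm, Prod.fst_sub, Prod.snd_sub, inner_sub_left]
  ring

lemma eq_zero_of_symplecticForm_eq_zero {q p : L2} (hq : q ∈ Q) {V : L2 × L2}
    (hV : V ∈ tangentCotangentQ q p)
    (hω : ∀ W ∈ tangentCotangentQ q p, symplecticForm V W = 0) : V = 0 := by
  obtain ⟨v, w⟩ := V
  have hv : v = 0 := by
    -- Pair with the vertical vector `(0, v / η)`, whose pairing with `(v, w)` is `∫ v² / η`.
    have hmem : (0, mulL2 (etaC (-q)) v) ∈ tangentCotangentQ q p := by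
      rw [zero_prodMk_mem_tangentCotangentQ_iff, ← mulL2_etaC_mem_tangentQ_iff,
        mulL2_etaC_mulL2_etaC_neg]
      exact (mem_tangentCotangentQ_iff.1 hV).1
    have := hω _ hmem
    rw [symplecticForm, inner_zero_right, sub_zero, real_inner_comm] at this
    exact eq_zero_of_inner_mulL2_etaC this
  subst hv
  have hw : w = 0 := by
    refine eq_zero_of_moment_eq_zero_of_orthogonal (zero_prodMk_mem_tangentCotangentQ_iff.1 hV)
      fun u hu => ?_
    obtain ⟨k, hk⟩ := exists_mem_tangentCotangentQ p hq hu
    simpa [symplecticForm] using hω _ hk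
  rw [hw, Prod.mk_zero_zero]

lemma hasFDerivAt_hamiltonian (q p : L2) : HasFDerivAt hamiltonian
    (innerSL ℝ (mulL2 (etaC q) p) ∘L ContinuousLinearMap.snd ℝ L2 L2 +
      (1 / 2 : ℝ) • innerSL ℝ (toL2 (tailC q p)) ∘L ContinuousLinearMap.fst ℝ L2 L2) (q, p) := by
  have hη : HasFDerivAt (fun z : L2 × L2 => mulL2 (etaC z.1)) _ (q, p) :=
    HasFDerivAt.comp (g := mulL2 ∘ etaC) (q, p)
      (mulL2.hasFDerivAt.comp q (hasFDerivAt_etaC q)) hasFDerivAt_fst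
  have hder := ((hη.clm_apply (hasFDerivAt_snd (p := (q, p)))).inner ℝ
    (hasFDerivAt_snd (p := (q, p)))).const_mul (1 / 2 : ℝ)
  rw [funext hamiltonian_eq]
  refine hder.congr_fderiv (ContinuousLinearMap.ext fun W => ?_)
  have hsymm : inner ℝ (mulL2 (etaC q) W.2) p = inner ℝ (mulL2 (etaC q) p) W.2 := by
    rw [inner_mulL2_left, real_inner_comm]
  simp only [one_div, smul_apply, ContinuousLinearMap.comp_apply, ContinuousLinearMap.prod_apply,
    add_apply, ContinuousLinearMap.coe_snd', ContinuousLinearMap.flip_apply,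
    ContinuousLinearMap.coe_fst', ContinuousLinearMap.mul_apply', fderivInnerCLM_apply,
    inner_add_left, hsymm, smul_eq_mul, coe_innerSL_apply, inner_toL2_tailC]
  ring

lemma symplecticForm_field {q p : L2} {W : L2 × L2} (hW : W.1 ∈ tangentQ q) :
    symplecticForm (field q p) W = fderiv ℝ hamiltonian (q, p) W := by
  rw [(hasFDerivAt_hamiltonian q p).fderiv]
  simp [symplecticForm, field, momentumC, inner_add_left, real_inner_smul_left,
    inner_multiplier_of_mem_tangentQ hW]

/-! ### The chart `q ↦ ∂ₓη(q)` -/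

lemma absolutelyContinuousOnInterval_eta (q : L2) :
    AbsolutelyContinuousOnInterval (eta q) 0 1 := by
  have hprim := absolutelyContinuousOnInterval_primitive (integrable_L2 q)
  obtain ⟨C, hC⟩ := hprim.exists_bound
  obtain ⟨K, hK⟩ := (Real.contDiff_exp (n := 1)).contDiffOn.exists_lipschitzOnWith
    (s := Icc (-C) C) one_ne_zero (convex_Icc _ _) isCompact_Icc
  exact absolutelyContinuousOnInterval_comp_of_lipschitzOnWith hprim hK
    fun x hx => abs_le.1 (hC x hx)

/-- The derivative `∂ₓη(q) = q η(q)`. It is a global chart of `L²([0,1])` onto the open set of the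
`w` with `1 + ∫₀ˣ w` invertible, in which `Q` is the trace of a linear subspace. -/
def derivEta (q : L2) : L2 := mulL2 (etaC q) q

lemma etaC_eq_one_add_prim (q : L2) : etaC q = 1 + prim (derivEta q) := by
  ext x
  have hsub : uIcc (0 : ℝ) x ⊆ uIcc (0 : ℝ) 1 :=
    uIcc_subset_uIcc left_mem_uIcc (by rw [uIcc_of_le zero_le_one]; exact x.2)
  have hderiv : ∫ y in (0 : ℝ)..x, deriv (eta q) y = ∫ y in (0 : ℝ)..x, derivEta q y := by
    refine intervalIntegral_congr_ae_μI ?_ zero_mem_I x.2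
    filter_upwards [ae_hasDerivAt_primitive (integrable_L2 q), coeFn_mulL2_etaC q q] with y hy hmul
    rw [derivEta, hmul]
    exact hy.exp.deriv
  have hzero : eta q 0 = 1 := by rw [eta, intervalIntegral.integral_same, Real.exp_zero]
  rw [ContinuousMap.add_apply, prim_apply, etaC_apply, ContinuousMap.one_apply, ← hderiv,
    ((absolutelyContinuousOnInterval_eta q).mono hsub).integral_deriv_eq_sub, hzero,
    add_sub_cancel]

/-- The inverse chart `w ↦ w / (1 + ∫₀ˣ w)`. -/
def logDerivMap (w : L2) : L2 := mulL2 (Ring.inverse (1 + prim w)) w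

lemma isUnit_etaC (q : L2) : IsUnit (etaC q) :=
  IsUnit.of_mul_eq_one _ (etaC_mul_etaC_neg q)

lemma isUnit_one_add_prim_derivEta (q : L2) : IsUnit (1 + prim (derivEta q)) := by
  rw [← etaC_eq_one_add_prim]
  exact isUnit_etaC q

lemma logDerivMap_derivEta (q : L2) : logDerivMap (derivEta q) = q := by
  rw [logDerivMap, ← etaC_eq_one_add_prim, derivEta, mulL2_mulL2,
    Ring.inverse_mul_cancel _ (isUnit_etaC q), one_mulL2]

/-- Uniqueness for `u' = q u`, `u(0) = 1`: the quotient `u / η(q)` has zero derivative. -/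
lemma etaC_eq_one_add_prim_of_mulL2_eq {q w : L2} (h : mulL2 (1 + prim w) q = w) :
    etaC q = 1 + prim w := by
  have hinv := etaC_eq_one_add_prim (-q)
  have hprod := prim_mul_prim w (derivEta (-q))
  have hleft : mulL2 (prim w) (derivEta (-q)) = -mulL2 (etaC (-q)) w - derivEta (-q) := by
    conv_rhs => rw [← h]
    simp only [derivEta, map_neg, mulL2_mulL2, map_add, add_apply, mul_one]
    rw [mul_comm]
    abel
  have hright : mulL2 (prim (derivEta (-q))) w = mulL2 (etaC (-q)) w - w := by
    rw [hinv, map_add, add_apply, one_mulL2, add_sub_cancel_left]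
  have hone : (1 + prim w) * etaC (-q) = 1 := by
    rw [hinv, mul_add, mul_one, add_mul, one_mul, hprod, hleft, hright]
    simp only [map_sub, map_neg]
    abel
  calc etaC q = (1 + prim w) * etaC (-q) * etaC q := by rw [hone, one_mul]
    _ = 1 + prim w := by rw [mul_assoc, etaC_neg_mul_etaC, mul_one]

lemma derivEta_logDerivMap {w : L2} (hw : IsUnit (1 + prim w)) : derivEta (logDerivMap w) = w := by
  have hmul : mulL2 (1 + prim w) (logDerivMap w) = w := by
    rw [logDerivMap, mulL2_mulL2, Ring.mul_inverse_cancel _ hw, one_mulL2]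
  rw [derivEta, etaC_eq_one_add_prim_of_mulL2_eq hmul, hmul]

lemma contDiff_derivEta {n : WithTop ℕ∞} : ContDiff ℝ n derivEta :=
  (mulL2.contDiff.comp contDiff_etaC).clm_apply contDiff_id

lemma contDiffAt_logDerivMap {n : WithTop ℕ∞} {w : L2} (hw : IsUnit (1 + prim w)) :
    ContDiffAt ℝ n logDerivMap w := by
  obtain ⟨u, hu⟩ := hw
  have hinv : ContDiffAt ℝ n Ring.inverse (1 + prim w) := hu ▸ contDiffAt_ringInverse ℝ u
  exact (mulL2.contDiff.contDiffAt.comp w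
    (hinv.comp w (contDiffAt_const.add prim.contDiff.contDiffAt))).clm_apply contDiffAt_id

lemma isOpen_setOf_isUnit_one_add_prim : IsOpen {w : L2 | IsUnit (1 + prim w)} :=
  Units.isOpen.preimage (continuous_const.add prim.continuous)

/-- The second derivatives of the elements of `H₀²`: the `w` with `∫₀¹ w = ∫₀¹ ∫₀ˣ w = 0`. -/
def secondDerivSubmodule : Submodule ℝ L2 :=
  (innerSL ℝ oneL2).ker ⊓ (innerSL ℝ oneL2 ∘L toL2 ∘L prim).ker

lemma mem_secondDerivSubmodule_iff {w : L2} : w ∈ secondDerivSubmodule ↔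
    inner ℝ oneL2 w = 0 ∧ inner ℝ oneL2 (toL2 (prim w)) = 0 := Iff.rfl

lemma inner_oneL2_oneL2 : inner ℝ oneL2 oneL2 = 1 := by
  rw [← prim_oneI, prim_apply, intervalIntegral_congr_ae_μI coeFn_oneL2 zero_mem_I oneI.2]
  simp [oneI]

lemma derivEta_mem_secondDerivSubmodule_iff {q : L2} :
    derivEta q ∈ secondDerivSubmodule ↔ q ∈ Q := by
  have hexp : inner ℝ oneL2 (derivEta q) = Real.exp (inner ℝ oneL2 q) - 1 := by
    have heval := congrArg (fun g : CI => g oneI) (etaC_eq_one_add_prim q)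
    rw [ContinuousMap.add_apply, ContinuousMap.one_apply, prim_oneI, etaC_apply, eta, ← prim_apply,
      prim_oneI] at heval
    rw [heval, add_sub_cancel_left]
  have hmass : inner ℝ oneL2 (toL2 (prim (derivEta q))) = inner ℝ oneL2 (toL2 (etaC q)) - 1 := by
    rw [etaC_eq_one_add_prim q, map_add, inner_add_right, toL2_one, inner_oneL2_oneL2,
      add_sub_cancel_left]
  rw [mem_secondDerivSubmodule_iff, mem_Q_iff, hexp, hmass, sub_eq_zero, sub_eq_zero,
    Real.exp_eq_one_iff]

lemma logDerivMap_mem_Q {w : L2} (hw : IsUnit (1 + prim w)) (hw' : w ∈ secondDerivSubmodule) :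
    logDerivMap w ∈ Q := by
  rwa [← derivEta_mem_secondDerivSubmodule_iff, derivEta_logDerivMap hw]

lemma hasFDerivAt_derivEta (q : L2) : HasFDerivAt derivEta (fderiv ℝ derivEta q) q :=
  ((contDiff_derivEta (n := 1)).differentiable one_ne_zero q).hasFDerivAt

lemma hasFDerivAt_logDerivMap {w : L2} (hw : IsUnit (1 + prim w)) :
    HasFDerivAt logDerivMap (fderiv ℝ logDerivMap w) w :=
  ((contDiffAt_logDerivMap (n := 1) hw).differentiableAt one_ne_zero).hasFDerivAt

lemma fderiv_logDerivMap_derivEta (q h : L2) :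
    fderiv ℝ logDerivMap (derivEta q) (fderiv ℝ derivEta q h) = h :=
  congrArg (· h) <| ((hasFDerivAt_logDerivMap (isUnit_one_add_prim_derivEta q)).comp q
    (hasFDerivAt_derivEta q)).unique
      ((hasFDerivAt_id q).congr_of_eventuallyEq (Eventually.of_forall logDerivMap_derivEta))

lemma prim_fderiv_derivEta (q h : L2) : prim (fderiv ℝ derivEta q h) = etaC q * prim h := by
  have hder : HasFDerivAt (fun q => 1 + prim (derivEta q)) (prim ∘L fderiv ℝ derivEta q) q :=
    (prim.hasFDerivAt.comp q (hasFDerivAt_derivEta q)).const_add 1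
  rw [← funext etaC_eq_one_add_prim] at hder
  exact congrArg (· h) (hder.unique (hasFDerivAt_etaC q))

lemma inner_oneL2_toL2_etaC_mul_prim {q : L2} (hq : q ∈ Q) (h : L2) :
    inner ℝ oneL2 (toL2 (etaC q * prim h)) = inner ℝ oneL2 h - inner ℝ (toL2 (phiC q)) h := by
  rw [phiC, inner_toL2_prim, (mem_Q_iff.1 hq).2, one_mul, inner_toL2_toL2, sub_sub_cancel]

lemma fderiv_derivEta_mem_secondDerivSubmodule {q h : L2} (hq : q ∈ Q) (hh : h ∈ tangentQ q) :
    fderiv ℝ derivEta q h ∈ secondDerivSubmodule := by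
  rw [mem_secondDerivSubmodule_iff, ← prim_oneI, prim_fderiv_derivEta, ContinuousMap.mul_apply,
    prim_oneI, inner_oneL2_toL2_etaC_mul_prim hq, inner_oneL2_of_mem_tangentQ hh,
    inner_phiC_of_mem_tangentQ hh, mul_zero, sub_zero]
  exact ⟨rfl, rfl⟩

/-! ### Tangent cones -/

lemma mem_tangentQ_of_mem_tangentConeAt {q h : L2} (hq : q ∈ Q)
    (hh : h ∈ tangentConeAt ℝ Q q) : h ∈ tangentQ q := by
  have hmean : inner ℝ oneL2 h = 0 :=
    apply_eq_zero_of_mem_tangentConeAt hh (innerSL ℝ oneL2).hasFDerivWithinAt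
      fun _ hu => (mem_Q_iff.1 hu).1
  have hmass : inner ℝ oneL2 (toL2 (etaC q * prim h)) = 0 :=
    apply_eq_zero_of_mem_tangentConeAt hh ((innerSL ℝ oneL2 ∘L toL2).hasFDerivAt.comp q
      (hasFDerivAt_etaC q)).hasFDerivWithinAt fun _ hu => (mem_Q_iff.1 hu).2
  rw [inner_oneL2_toL2_etaC_mul_prim hq, hmean, zero_sub, neg_eq_zero] at hmass
  refine mem_tangentQ_iff.2 fun k => ?_
  match k with
  | 0 => rwa [Fin.val_zero, pow_zero, toL2_one]
  | 1 => rwa [Fin.val_one, pow_one]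

lemma mem_tangentCotangentQ_of_mem_tangentConeAt {q p : L2} (h : (q, p) ∈ cotangentQ)
    {V : L2 × L2} (hV : V ∈ tangentConeAt ℝ cotangentQ (q, p)) : V ∈ tangentCotangentQ q p := by
  have hfst : V.1 ∈ tangentConeAt ℝ Q q :=
    tangentConeAt_mono (image_subset_iff.2 fun z hz => hz.1)
      ((hasFDerivWithinAt_fst (𝕜 := ℝ)).mapsTo_tangent_cone hV)
  exact mem_tangentCotangentQ_iff.2 ⟨mem_tangentQ_of_mem_tangentConeAt h.1 hfst, fun k =>
    apply_eq_zero_of_mem_tangentConeAt hV (hasFDerivAt_moment k (q, p)).hasFDerivWithinAt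
      fun _ hz => (mem_cotangentQ_iff.1 hz).2 k⟩

/-- The curve through `q` which in the chart `derivEta` is the line of direction `w`. -/
def chartLine (q w : L2) (s : ℝ) : L2 := logDerivMap (derivEta q + s • w)

lemma chartLine_zero (q w : L2) : chartLine q w 0 = q := by
  rw [chartLine, zero_smul, add_zero, logDerivMap_derivEta]

lemma hasDerivAt_chartLine (q w : L2) :
    HasDerivAt (chartLine q w) (fderiv ℝ logDerivMap (derivEta q) w) 0 := by
  refine HasFDerivAt.comp_hasDerivAt 0 ?_ (hasDerivAt_const_add_smul (derivEta q) w 0)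
  rw [zero_smul, add_zero]
  exact hasFDerivAt_logDerivMap (isUnit_one_add_prim_derivEta q)

lemma chartLine_mem_Q {q w : L2} (hq : q ∈ Q) (hw : w ∈ secondDerivSubmodule) {s : ℝ}
    (hs : IsUnit (1 + prim (derivEta q + s • w))) : chartLine q w s ∈ Q :=
  logDerivMap_mem_Q hs (add_mem (derivEta_mem_secondDerivSubmodule_iff.2 hq)
    (Submodule.smul_mem _ _ hw))

lemma eventually_chartLine_mem_Q {q w : L2} (hq : q ∈ Q) (hw : w ∈ secondDerivSubmodule) :
    ∀ᶠ s in 𝓝 (0 : ℝ), chartLine q w s ∈ Q := by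
  have hcont : Continuous fun s : ℝ => derivEta q + s • w := by fun_prop
  have hopen := (isOpen_setOf_isUnit_one_add_prim.preimage hcont).mem_nhds
    (show (0 : ℝ) ∈ _ by simpa using isUnit_one_add_prim_derivEta q)
  filter_upwards [hopen] with s hs
  exact chartLine_mem_Q hq hw hs

/-- The momentum obtained from `p` by subtracting the combination of `1` and `φ(q)` that has the
same moments; for `q ∈ Q` it is a covector at `q`. -/
def cotangentProj (q p : L2) : L2 := p - toL2 (multiplier q fun k => moment k q p)

lemma prodMk_cotangentProj_mem_cotangentQ {q : L2} (hq : q ∈ Q) (p : L2) :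
    (q, cotangentProj q p) ∈ cotangentQ := by
  refine mem_cotangentQ_iff.2 ⟨hq, fun k => ?_⟩
  rw [cotangentProj, moment, inner_sub_right]
  exact sub_eq_zero.2 (moment_toL2_multiplier hq (fun k => moment k q p) k).symm

lemma hasDerivAt_toL2_multiplier {c : ℝ → L2} {c' : L2} {F : ℝ → Fin 2 → ℝ}
    (hc : HasDerivAt c c' 0) (hF : HasDerivAt F 0 0) (hF₀ : F 0 = 0) :
    HasDerivAt (fun s => toL2 (multiplier (c s) (F s))) 0 0 := by
  have hcoef : HasDerivAt (fun s => hilbertMatrix⁻¹.mulVec (F s)) 0 0 := by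
    exact (hilbertMatrix⁻¹.mulVecLin.toContinuousLinearMap.hasFDerivAt.comp_hasDerivAt 0
      hF).congr_deriv (map_zero _)
  have hpow (j : ℕ) : HasDerivAt (fun s => phiC (c s) ^ j) _ 0 :=
    ((hasFDerivAt_phiC (c 0)).comp_hasDerivAt 0 hc).pow j
  have hsum := HasDerivAt.fun_sum (u := Finset.univ) fun (j : Fin 2) _ =>
    (hasDerivAt_pi.1 hcoef j).fun_smul (hpow j)
  refine (toL2.hasFDerivAt.comp_hasDerivAt 0 hsum).congr_deriv ?_
  simp only [hF₀, Matrix.mulVec_zero, Pi.zero_apply, zero_smul, add_zero, Finset.sum_const_zero,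
    map_zero]

lemma mem_tangentConeAt_of_mem_tangentCotangentQ {q p : L2} (h : (q, p) ∈ cotangentQ)
    {V : L2 × L2} (hV : V ∈ tangentCotangentQ q p) : V ∈ tangentConeAt ℝ cotangentQ (q, p) := by
  obtain ⟨hq, hp⟩ := mem_cotangentQ_iff.1 h
  obtain ⟨hV₁, hV₂⟩ := mem_tangentCotangentQ_iff.1 hV
  have hw := fderiv_derivEta_mem_secondDerivSubmodule hq hV₁
  set c := chartLine q (fderiv ℝ derivEta q V.1)
  set l : ℝ → L2 := fun s => p + s • V.2
  have hc : HasDerivAt c V.1 0 :=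
    (hasDerivAt_chartLine q _).congr_deriv (fderiv_logDerivMap_derivEta q V.1)
  have hl : HasDerivAt l V.2 0 := hasDerivAt_const_add_smul p V.2 0
  have hcl : (c 0, l 0) = (q, p) :=
    Prod.ext (chartLine_zero q _) (by simp only [l, zero_smul, add_zero])
  have hmoment : HasDerivAt (fun s (k : Fin 2) => moment k (c s) (l s)) 0 0 := by
    refine hasDerivAt_pi.2 fun k => ?_
    have hder := hasFDerivAt_moment k (c 0, l 0)
    exact (HasFDerivAt.comp_hasDerivAt (0 : ℝ) hder (hc.prodMk hl)).congr_deriv (hcl ▸ hV₂ k)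
  have hmoment₀ : (fun k : Fin 2 => moment k (c 0) (l 0)) = 0 :=
    funext fun k => by rw [(Prod.mk.inj hcl).1, (Prod.mk.inj hcl).2]; exact hp k
  have hcurve : HasDerivAt (fun s => (c s, cotangentProj (c s) (l s))) V 0 :=
    (hc.prodMk (hl.fun_sub (hasDerivAt_toL2_multiplier hc hmoment hmoment₀))).congr_deriv
      (Prod.ext rfl (sub_zero _))
  have hpoint : (c 0, cotangentProj (c 0) (l 0)) = (q, p) := by
    rw [cotangentProj, hmoment₀, ← hcl]
    simp [multiplier]
  rw [← hpoint]
  refine mem_tangentConeAt_of_hasDerivWithinAt (uniqueDiffWithinAt_of_mem_nhds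
    (eventually_chartLine_mem_Q hq hw)) hcurve.hasDerivWithinAt fun s hs =>
      prodMk_cotangentProj_mem_cotangentQ hs (l s)

lemma mem_tangentConeAt_cotangentQ_iff {q p : L2} (h : (q, p) ∈ cotangentQ) {V : L2 × L2} :
    V ∈ tangentConeAt ℝ cotangentQ (q, p) ↔ V ∈ tangentCotangentQ q p :=
  ⟨mem_tangentCotangentQ_of_mem_tangentConeAt h, mem_tangentConeAt_of_mem_tangentCotangentQ h⟩

theorem hamiltonian_vectorField {q p : L2} (h : (q, p) ∈ cotangentQ) :
    ∃ dH : (L2 × L2) →L[ℝ] ℝ, HasFDerivAt hamiltonian dH (q, p) ∧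
      ∃ X ∈ tangentConeAt ℝ cotangentQ (q, p), IsFieldAt q p X ∧
        ∀ V ∈ tangentConeAt ℝ cotangentQ (q, p),
          (∀ W ∈ tangentConeAt ℝ cotangentQ (q, p), symplecticForm V W = dH W) ↔ V = X := by
  have hfield := field_mem_tangentCotangentQ h
  have hω (W) (hW : W ∈ tangentCotangentQ q p) :
      symplecticForm (field q p) W = fderiv ℝ hamiltonian (q, p) W :=
    symplecticForm_field (mem_tangentCotangentQ_iff.1 hW).1
  simp only [mem_tangentConeAt_cotangentQ_iff h]
  refine ⟨_, (hasFDerivAt_hamiltonian q p).differentiableAt.hasFDerivAt, field q p, hfield,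
    (isFieldAt_iff h.1 p _).2 rfl, fun V hV => ⟨fun hVω => ?_, ?_⟩⟩
  · refine sub_eq_zero.1 (eq_zero_of_symplecticForm_eq_zero h.1 (sub_mem hV hfield) fun W hW => ?_)
    rw [symplecticForm_sub_left, hVω W hW, hω W hW, sub_self]
  · rintro rfl
    exact hω

/-! ### First variation of the energy of `Q` -/

lemma contDiff_hamiltonian {n : WithTop ℕ∞} : ContDiff ℝ n hamiltonian := by
  rw [funext hamiltonian_eq]
  exact contDiff_const.mul (((mulL2.contDiff.comp (contDiff_etaC.comp contDiff_fst)).clm_apply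
    contDiff_snd).inner ℝ contDiff_snd)

/-- The Lagrangian `½ G(q)(v, v)` of `Q`.  Since `1 / η(q) = η(-q)`, it is the Hamiltonian at
`(-q, v)`. -/
def lagrangianQ (z : L2 × L2) : ℝ := hamiltonian (-z.1, z.2)

lemma contDiff_lagrangianQ {n : WithTop ℕ∞} : ContDiff ℝ n lagrangianQ :=
  contDiff_hamiltonian.comp (contDiff_fst.neg.prodMk contDiff_snd)

lemma energy_metricQ (a b : ℝ) (γ : ℝ → L2) : energy metricQ a b γ =
    ∫ t in a..b, lagrangianQ (γ t, derivWithin γ (Icc a b) t) := by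
  rw [energy, ← intervalIntegral.integral_const_mul]
  simp only [metricQ_eq, lagrangianQ, hamiltonian_eq]

lemma tailC_neg_mulL2_etaC (q p : L2) : tailC (-q) (mulL2 (etaC q) p) = tailC q p := by
  rw [tailC, tailC, mulL2_etaC_neg_mulL2_etaC, primMul_comm, real_inner_comm]

lemma fderiv_lagrangianQ_apply (q p h k : L2) :
    fderiv ℝ lagrangianQ (q, mulL2 (etaC q) p) (h, k) =
      inner ℝ p k + inner ℝ (-(1 / 2 : ℝ) • toL2 (tailC q p)) h := by
  have hneg : HasFDerivAt (fun z : L2 × L2 => (-z.1, z.2))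
      ((-ContinuousLinearMap.fst ℝ L2 L2).prod (ContinuousLinearMap.snd ℝ L2 L2))
      (q, mulL2 (etaC q) p) := hasFDerivAt_fst.neg.prodMk hasFDerivAt_snd
  have hder := HasFDerivAt.comp (g := hamiltonian) (q, mulL2 (etaC q) p)
    (hasFDerivAt_hamiltonian (-q) (mulL2 (etaC q) p)) hneg
  rw [show lagrangianQ = hamiltonian ∘ fun z : L2 × L2 => (-z.1, z.2) from rfl, hder.fderiv,
    tailC_neg_mulL2_etaC, mulL2_etaC_neg_mulL2_etaC, real_inner_smul_left]
  simp

/-- The Euler–Lagrange expression of a curve `q` with momentum `p = q̇ / η(q)`. -/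
def eulerLagrangeQ (a b : ℝ) (q p : ℝ → L2) (t : ℝ) : L2 :=
  -(1 / 2 : ℝ) • toL2 (tailC (q t) (p t)) - derivWithin p (Icc a b) t

lemma continuous_tailC : Continuous fun z : L2 × L2 => tailC z.1 z.2 := by
  have hη : Continuous etaC := contDiff_etaC.continuous (n := 0)
  unfold tailC
  fun_prop

lemma continuousOn_toL2_tailC {s : Set ℝ} {q p : ℝ → L2} (hq : ContinuousOn q s)
    (hp : ContinuousOn p s) :
    ContinuousOn (fun t => -(1 / 2 : ℝ) • toL2 (tailC (q t) (p t))) s := by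
  have htail : ContinuousOn (fun t => tailC (q t) (p t)) s :=
    continuous_tailC.comp_continuousOn (f := fun t => (q t, p t)) (hq.prodMk hp)
  exact (toL2.continuous.comp_continuousOn htail).const_smul (-(1 / 2 : ℝ))

section FirstVariation

variable {a b ε : ℝ} {q p : ℝ → L2} {Γ : ℝ → ℝ → L2}

theorem IsVariation.hasDerivAt_energy_metricQ (hΓ : IsVariation Q a b q ε Γ) (hab : a < b)
    (hε : 0 < ε)
    (hq : ∀ t ∈ Icc a b, HasDerivWithinAt q (mulL2 (etaC (q t)) (p t)) (Icc a b) t)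
    (hp : ContDiffOn ℝ 1 p (Icc a b)) :
    HasDerivAt (fun s => energy metricQ a b (Γ s))
      (∫ t in a..b, inner ℝ (eulerLagrangeQ a b q p t) (variationField Γ t)) 0 := by
  have hT := uniqueDiffOn_Icc hab
  have hδ := hΓ.contDiffOn_variationField hab hε
  have htail := continuousOn_toL2_tailC (fun t ht => (hq t ht).continuousWithinAt) hp.continuousOn
  have hintegral {u v : ℝ → L2} (hu : ContinuousOn u (Icc a b)) (hv : ContinuousOn v (Icc a b)) :
      IntervalIntegrable (fun t => inner ℝ (u t) (v t)) volume a b :=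
    (hu.inner hv).intervalIntegrable_of_Icc hab.le
  simp only [energy_metricQ]
  refine (hΓ.hasDerivAt_integral_lagrangian hab hε contDiff_lagrangianQ).congr_deriv ?_
  calc ∫ t in a..b, fderiv ℝ lagrangianQ (q t, derivWithin q (Icc a b) t)
        (variationField Γ t, derivWithin (variationField Γ) (Icc a b) t)
      = ∫ t in a..b, (inner ℝ (p t) (derivWithin (variationField Γ) (Icc a b) t) +
          inner ℝ (-(1 / 2 : ℝ) • toL2 (tailC (q t) (p t))) (variationField Γ t)) := by
        refine intervalIntegral.integral_congr fun t ht => ?_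
        rw [uIcc_of_le hab.le] at ht
        simp only [(hq t ht).derivWithin (hT t ht), fderiv_lagrangianQ_apply]
    _ = -(∫ t in a..b, inner ℝ (derivWithin p (Icc a b) t) (variationField Γ t)) +
          ∫ t in a..b, inner ℝ (-(1 / 2 : ℝ) • toL2 (tailC (q t) (p t))) (variationField Γ t) := by
        rw [intervalIntegral.integral_add
            (hintegral hp.continuousOn (hδ.continuousOn_derivWithin hT le_rfl))
            (hintegral htail hδ.continuousOn),
          integral_inner_derivWithin hab hp hδ (hΓ.variationField_left hε)
            (hΓ.variationField_right hε)]
    _ = ∫ t in a..b, inner ℝ (eulerLagrangeQ a b q p t) (variationField Γ t) := by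
        rw [neg_add_eq_sub, ← intervalIntegral.integral_sub (hintegral htail hδ.continuousOn)
          (hintegral (hp.continuousOn_derivWithin hT le_rfl) hδ.continuousOn)]
        simp only [eulerLagrangeQ, inner_sub_left]

lemma IsVariation.variationField_mem_tangentQ (hΓ : IsVariation Q a b q ε Γ) (hε : 0 < ε)
    {t : ℝ} (ht : t ∈ Icc a b) : variationField Γ t ∈ tangentQ (q t) := by
  have h0 : (0 : ℝ) ∈ Ioo (-ε) ε := ⟨neg_lt_zero.2 hε, hε⟩
  have hmem := mem_tangentQ_of_mem_tangentConeAt (hΓ.mem 0 h0 t ht)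
    (mem_tangentConeAt_of_hasDerivWithinAt (c := fun s => Γ s t)
      (isOpen_Ioo.uniqueDiffWithinAt h0) (hΓ.hasDerivAt hε ht).hasDerivWithinAt
      fun s hs => hΓ.mem s hs t ht)
  rwa [hΓ.eq_zero t ht] at hmem

lemma inner_eulerLagrangeQ_of_mem_tangentQ {t : ℝ} {v : L2} (hv : v ∈ tangentQ (q t)) :
    inner ℝ (eulerLagrangeQ a b q p t) v =
      inner ℝ ((field (q t) (p t)).2 - derivWithin p (Icc a b) t) v := by
  simp only [eulerLagrangeQ, field, momentumC, map_add, map_smul, inner_sub_left, inner_add_left,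
    inner_multiplier_of_mem_tangentQ hv, add_zero]

end FirstVariation

/-! ### Geodesics of `Q` -/

section GeodesicsOfQ

variable {a b : ℝ} {q p : ℝ → L2}

lemma isHamiltonianSolution_iff : IsHamiltonianSolution a b q p ↔
    ∀ t ∈ Icc a b, (q t, p t) ∈ cotangentQ ∧
      HasDerivWithinAt q (field (q t) (p t)).1 (Icc a b) t ∧
      HasDerivWithinAt p (field (q t) (p t)).2 (Icc a b) t := by
  refine forall₂_congr fun t _ => and_congr_right fun h => ?_
  simp only [isFieldAt_iff h.1, exists_eq_left]

lemma contDiffOn_mulL2_etaC (hq : ContDiffOn ℝ 1 q (Icc a b)) (hp : ContDiffOn ℝ 1 p (Icc a b)) :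
    ContDiffOn ℝ 1 (fun t => mulL2 (etaC (q t)) (p t)) (Icc a b) :=
  (mulL2.contDiff.comp_contDiffOn (contDiff_etaC.comp_contDiffOn hq)).clm_apply hp

lemma IsHamiltonianSolution.contDiffOn_one (hab : a < b) (h : IsHamiltonianSolution a b q p) :
    ContDiffOn ℝ 1 q (Icc a b) ∧ ContDiffOn ℝ 1 p (Icc a b) := by
  rw [isHamiltonianSolution_iff] at h
  have hfield : ContinuousOn (fun t => field (q t) (p t)) (Icc a b) :=
    continuous_field.comp_continuousOn (ContinuousOn.prodMk
      (fun t ht => (h t ht).2.1.continuousWithinAt) fun t ht => (h t ht).2.2.continuousWithinAt)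
  exact ⟨contDiffOn_one_of_hasDerivWithinAt (uniqueDiffOn_Icc hab) (fun t ht => (h t ht).2.1)
      hfield.fst,
    contDiffOn_one_of_hasDerivWithinAt (uniqueDiffOn_Icc hab) (fun t ht => (h t ht).2.2)
      hfield.snd⟩

lemma IsHamiltonianSolution.contDiffOn_two (hab : a < b) (h : IsHamiltonianSolution a b q p) :
    ContDiffOn ℝ 2 q (Icc a b) := by
  have hT := uniqueDiffOn_Icc hab
  obtain ⟨hq, hp⟩ := h.contDiffOn_one hab
  rw [show (2 : WithTop ℕ∞) = 1 + 1 from one_add_one_eq_two.symm,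
    contDiffOn_succ_iff_derivWithin hT]
  exact ⟨hq.differentiableOn one_ne_zero, by simp, (contDiffOn_mulL2_etaC hq hp).congr fun t ht =>
    ((isHamiltonianSolution_iff.1 h) t ht).2.1.derivWithin (hT t ht)⟩

theorem IsHamiltonianSolution.isGeodesic (hab : a < b) (h : IsHamiltonianSolution a b q p) :
    IsGeodesic Q metricQ a b q where
  mem t ht := (h t ht).1.1
  contDiffOn := h.contDiffOn_two hab
  critical ε hε Γ hΓ := by
    have hsol := isHamiltonianSolution_iff.1 h
    refine (hΓ.hasDerivAt_energy_metricQ hab hε (fun t ht => (hsol t ht).2.1)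
      (h.contDiffOn_one hab).2).congr_deriv ?_
    refine (intervalIntegral.integral_congr fun t ht => ?_).trans intervalIntegral.integral_zero
    rw [uIcc_of_le hab.le] at ht
    simp only [inner_eulerLagrangeQ_of_mem_tangentQ (hΓ.variationField_mem_tangentQ hε ht),
      (hsol t ht).2.2.derivWithin (uniqueDiffOn_Icc hab t ht), sub_self, inner_zero_left]

lemma exists_pos_forall_isUnit_one_add_prim {w : ℝ → L2} {v : ℝ → L2}
    (hw : ContinuousOn w (Icc a b)) (hv : ContinuousOn v (Icc a b))
    (hunit : ∀ t ∈ Icc a b, IsUnit (1 + prim (w t))) :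
    ∃ ε > (0 : ℝ), ∀ s ∈ Ioo (-ε) ε, ∀ t ∈ Icc a b, IsUnit (1 + prim (w t + s • v t)) := by
  obtain ⟨r, hr, hrU⟩ := (isCompact_Icc.image_of_continuousOn hw).exists_thickening_subset_open
    isOpen_setOf_isUnit_one_add_prim (image_subset_iff.2 hunit)
  obtain ⟨C, hC⟩ := isCompact_Icc.exists_bound_of_continuousOn hv
  refine ⟨r / (|C| + 1), by positivity, fun s hs t ht => ?_⟩
  refine hrU (Metric.mem_thickening_iff.2 ⟨w t, mem_image_of_mem _ ht, ?_⟩)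
  have hs' : ‖s‖ * (|C| + 1) < r := (lt_div_iff₀ (by positivity)).1 (abs_lt.2 hs)
  have hCt : ‖v t‖ ≤ |C| + 1 := (hC t ht).trans ((le_abs_self C).trans (lt_add_one _).le)
  rw [dist_eq_norm, add_sub_cancel_left, norm_smul]
  exact (mul_le_mul_of_nonneg_left hCt (norm_nonneg s)).trans_lt hs'

theorem exists_isVariation_chartLine (hq : ContDiffOn ℝ 2 q (Icc a b))
    (hQ : ∀ t ∈ Icc a b, q t ∈ Q) {k : L2} (hk : k ∈ secondDerivSubmodule) {χ : ℝ → ℝ}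
    (hχ : ContDiff ℝ 2 χ) (ha : χ a = 0) (hb : χ b = 0) :
    ∃ ε > (0 : ℝ), IsVariation Q a b q ε fun s t => chartLine (q t) (χ t • k) s := by
  have hw : ContDiffOn ℝ 2 (fun t => derivEta (q t)) (Icc a b) :=
    contDiff_derivEta.comp_contDiffOn hq
  have hv : ContDiff ℝ 2 fun t => χ t • k := hχ.smul contDiff_const
  obtain ⟨ε, hε, hunit⟩ := exists_pos_forall_isUnit_one_add_prim hw.continuousOn
    hv.continuous.continuousOn fun t _ => isUnit_one_add_prim_derivEta (q t)
  refine ⟨ε, hε, ⟨fun z hz => ?_, fun s hs t ht => ?_, fun t _ => chartLine_zero _ _, ?_, ?_⟩⟩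
  · have hchart : ContDiffOn ℝ 2 (fun z : ℝ × ℝ => derivEta (q z.2) + z.1 • χ z.2 • k)
        (Ioo (-ε) ε ×ˢ Icc a b) :=
      (hw.comp contDiff_snd.contDiffOn fun z hz => hz.2).add
        (contDiff_fst.smul (hv.comp contDiff_snd)).contDiffOn
    exact (contDiffAt_logDerivMap (hunit z.1 hz.1 z.2 hz.2)).comp_contDiffWithinAt z (hchart z hz)
  · exact chartLine_mem_Q (hQ t ht) (Submodule.smul_mem _ _ hk) (hunit s hs t ht)
  · intro s _
    simp only [chartLine, ha, zero_smul, smul_zero, add_zero, logDerivMap_derivEta]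
  · intro s _
    simp only [chartLine, hb, zero_smul, smul_zero, add_zero, logDerivMap_derivEta]

lemma inner_eulerLagrangeQ_eq_zero (hab : a < b) (h : IsGeodesic Q metricQ a b q)
    (hq : ∀ t ∈ Icc a b, HasDerivWithinAt q (mulL2 (etaC (q t)) (p t)) (Icc a b) t)
    (hp : ContDiffOn ℝ 1 p (Icc a b)) {t : ℝ} (ht : t ∈ Icc a b) {v : L2}
    (hv : v ∈ tangentQ (q t)) : inner ℝ (eulerLagrangeQ a b q p t) v = 0 := by
  set k := fderiv ℝ derivEta (q t) v
  have hk : k ∈ secondDerivSubmodule := fderiv_derivEta_mem_secondDerivSubmodule (h.mem t ht) hv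
  set g : ℝ → ℝ := fun s =>
    inner ℝ (eulerLagrangeQ a b q p s) (fderiv ℝ logDerivMap (derivEta (q s)) k)
  have hg : ContinuousOn g (Icc a b) := by
    have hdir : ContinuousOn (fun s => fderiv ℝ logDerivMap (derivEta (q s))) (Icc a b) :=
      fun s hs => ContinuousAt.comp_continuousWithinAt (f := fun s => derivEta (q s))
        ((contDiffAt_logDerivMap (n := 1) (isUnit_one_add_prim_derivEta (q s))).fderiv_right
          (m := 0) (by simp)).continuousAt
        ((contDiff_derivEta (n := 0)).continuous.continuousAt.comp_continuousWithinAt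
          (h.contDiffOn.continuousOn s hs))
    exact ((continuousOn_toL2_tailC h.contDiffOn.continuousOn hp.continuousOn).sub
      (hp.continuousOn_derivWithin (uniqueDiffOn_Icc hab) le_rfl)).inner
        (hdir.clm_apply continuousOn_const)
  have hzero : EqOn g 0 (Icc a b) := by
    refine eq_zero_of_integral_smooth_mul_eq_zero hab hg fun χ hχ ha hb => ?_
    obtain ⟨ε, hε, hΓ⟩ := exists_isVariation_chartLine h.contDiffOn h.mem hk
      (hχ.of_le (WithTop.coe_le_coe.2 le_top)) ha hb
    rw [(h.critical ε hε _ hΓ).unique (hΓ.hasDerivAt_energy_metricQ hab hε hq hp)]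
    refine intervalIntegral.integral_congr fun s _ => ?_
    simp only [g, variationField, (hasDerivAt_chartLine (q s) (χ s • k)).deriv, map_smul,
      real_inner_smul_right]
  have hgt : inner ℝ (eulerLagrangeQ a b q p t) (fderiv ℝ logDerivMap (derivEta (q t)) k) = 0 :=
    hzero ht
  rwa [fderiv_logDerivMap_derivEta] at hgt

lemma mem_cotangentQ_of_hasDerivWithinAt (hab : a < b) (hQ : ∀ t ∈ Icc a b, q t ∈ Q)
    (hq : ∀ t ∈ Icc a b, HasDerivWithinAt q (mulL2 (etaC (q t)) (p t)) (Icc a b) t) {t : ℝ}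
    (ht : t ∈ Icc a b) : (q t, p t) ∈ cotangentQ :=
  mem_cotangentQ_iff.2 ⟨hQ t ht, mulL2_etaC_mem_tangentQ_iff.1 <|
    mem_tangentQ_of_mem_tangentConeAt (hQ t ht) <|
      mem_tangentConeAt_of_hasDerivWithinAt (uniqueDiffOn_Icc hab t ht) (hq t ht) hQ⟩

theorem IsGeodesic.exists_isHamiltonianSolution (hab : a < b) (h : IsGeodesic Q metricQ a b q) :
    ∃ p, IsHamiltonianSolution a b q p := by
  have hT := uniqueDiffOn_Icc hab
  set p : ℝ → L2 := fun t => mulL2 (etaC (-q t)) (derivWithin q (Icc a b) t)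
  have hp : ContDiffOn ℝ 1 p (Icc a b) :=
    contDiffOn_mulL2_etaC (h.contDiffOn.of_le one_le_two).neg
      (h.contDiffOn.derivWithin hT one_add_one_eq_two.le)
  have hq (t) (ht : t ∈ Icc a b) :
      HasDerivWithinAt q (mulL2 (etaC (q t)) (p t)) (Icc a b) t := by
    rw [mulL2_etaC_mulL2_etaC_neg]
    exact (h.contDiffOn.differentiableOn two_ne_zero t ht).hasDerivWithinAt
  have hp' (t) (ht : t ∈ Icc a b) : HasDerivWithinAt p (derivWithin p (Icc a b) t) (Icc a b) t :=
    (hp.differentiableOn one_ne_zero t ht).hasDerivWithinAt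
  have hcot (t) (ht : t ∈ Icc a b) : (q t, p t) ∈ cotangentQ :=
    mem_cotangentQ_of_hasDerivWithinAt hab h.mem hq ht
  refine ⟨p, isHamiltonianSolution_iff.2 fun t ht => ⟨hcot t ht, hq t ht, ?_⟩⟩
  have hvelocity : ((field (q t) (p t)).1, derivWithin p (Icc a b) t) ∈
      tangentCotangentQ (q t) (p t) :=
    mem_tangentCotangentQ_of_mem_tangentConeAt (hcot t ht) <|
      mem_tangentConeAt_of_hasDerivWithinAt (hT t ht) ((hq t ht).prodMk (hp' t ht)) hcot
  have hvertical := sub_mem (field_mem_tangentCotangentQ (hcot t ht)) hvelocity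
  rw [← Prod.mk.eta (p := field (q t) (p t)), Prod.mk_sub_mk, sub_self,
    zero_prodMk_mem_tangentCotangentQ_iff] at hvertical
  refine (hp' t ht).congr_deriv (sub_eq_zero.1 ?_).symm
  refine eq_zero_of_moment_eq_zero_of_orthogonal hvertical fun v hv => ?_
  rw [← inner_eulerLagrangeQ_of_mem_tangentQ hv, inner_eulerLagrangeQ_eq_zero hab h hq hp ht hv]

end GeodesicsOfQ

theorem isGeodesic_Q_iff {a b : ℝ} (hab : a < b) (q : ℝ → L2) :
    IsGeodesic Q metricQ a b q ↔ ∃ p : ℝ → L2, IsHamiltonianSolution a b q p :=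
  ⟨fun h => h.exists_isHamiltonianSolution hab, fun ⟨_, h⟩ => h.isGeodesic hab⟩

/-! ### The space `H₀²([0,1])` -/

lemma MemH02.eqOn_zero_Ici {f : ℝ → ℝ} (hf : MemH02 f) : EqOn f 0 (Ici 1) := by
  have hIoi : EqOn f 0 (Ioi 1) := fun x hx => hf.eq_zero x fun h => absurd h.2 (not_le.2 hx)
  simpa only [closure_Ioi] using hIoi.closure hf.differentiable.continuous continuous_zero

lemma MemH02.apply_one {f : ℝ → ℝ} (hf : MemH02 f) : f 1 = 0 :=
  hf.eqOn_zero_Ici self_mem_Ici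

lemma MemH02.deriv_one {f : ℝ → ℝ} (hf : MemH02 f) : deriv f 1 = 0 :=
  (uniqueDiffWithinAt_Ici 1).eq_deriv _ (hf.differentiable 1).hasDerivAt.hasDerivWithinAt
    ((hasDerivWithinAt_const 1 _ 0).congr hf.eqOn_zero_Ici hf.apply_one)

lemma MemH02.deriv_of_notMem {f : ℝ → ℝ} (hf : MemH02 f) {x : ℝ} (hx : x ∉ Icc (0 : ℝ) 1) :
    deriv f x = 0 := by
  have hzero : f =ᶠ[𝓝 x] fun _ => 0 := by
    filter_upwards [isClosed_Icc.isOpen_compl.mem_nhds hx] with y hy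
    exact hf.eq_zero y hy
  rw [hzero.deriv_eq, deriv_const]

lemma coeFn_secondDeriv (f : H02) : secondDeriv f =ᵐ[μI] deriv (deriv f) :=
  MemLp.coeFn_toLp f.memH02.memLp

lemma prim_secondDeriv (f : H02) (x : Icc (0 : ℝ) 1) : prim (secondDeriv f) x = deriv f x := by
  have hsub : uIcc (0 : ℝ) x ⊆ uIcc (0 : ℝ) 1 :=
    uIcc_subset_uIcc left_mem_uIcc (by rw [uIcc_of_le zero_le_one]; exact x.2)
  rw [prim_apply, intervalIntegral_congr_ae_μI (coeFn_secondDeriv f) zero_mem_I x.2,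
    (f.memH02.absCont.mono hsub).integral_deriv_eq_sub, f.memH02.deriv_eq_zero, sub_zero]

lemma prim_toL2_prim_secondDeriv (f : H02) (x : Icc (0 : ℝ) 1) :
    prim (toL2 (prim (secondDeriv f))) x = f x := by
  have hderiv (y) (hy : y ∈ Ioo (0 : ℝ) x) : HasDerivAt f (extI (prim (secondDeriv f)) y) y := by
    rw [extI_of_mem _ ⟨hy.1.le, hy.2.le.trans x.2.2⟩, prim_secondDeriv]
    exact (f.memH02.differentiable y).hasDerivAt
  rw [prim_apply, intervalIntegral_congr_ae_μI (coeFn_toL2 _) zero_mem_I x.2,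
    intervalIntegral.integral_eq_sub_of_hasDerivAt_of_le x.2.1
      f.memH02.differentiable.continuous.continuousOn hderiv
      ((continuous_extI _).intervalIntegrable _ _), f.memH02.apply_zero, sub_zero]

lemma secondDeriv_mem_secondDerivSubmodule (f : H02) : secondDeriv f ∈ secondDerivSubmodule := by
  rw [mem_secondDerivSubmodule_iff, ← prim_oneI, ← prim_oneI, prim_secondDeriv,
    prim_toL2_prim_secondDeriv]
  exact ⟨f.memH02.deriv_one, f.memH02.apply_one⟩

lemma ae_mem_Ioo : ∀ᵐ x ∂μI, x ∈ Ioo (0 : ℝ) 1 := by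
  rw [μI, ← Measure.restrict_congr_set Ioo_ae_eq_Icc]
  exact ae_restrict_mem measurableSet_Ioo

lemma ae_hasDerivAt_extI_prim (w : L2) : ∀ᵐ x ∂μI, HasDerivAt (extI (prim w)) (w x) x := by
  filter_upwards [ae_mem_Ioo, ae_hasDerivAt_primitive (integrable_L2 w)] with x hx hx'
  refine hx'.congr_of_eventuallyEq ?_
  filter_upwards [Icc_mem_nhds hx.1 hx.2] with y hy
  exact extI_prim w hy

/-- The double primitive `x ↦ ∫₀ˣ ∫₀ʸ w`, defined on the whole line by extending the inner
primitive by its values at `0` and `1`. -/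
def doublePrim (w : L2) (x : ℝ) : ℝ := ∫ y in (0 : ℝ)..x, extI (prim w) y

lemma hasDerivAt_doublePrim (w : L2) (x : ℝ) : HasDerivAt (doublePrim w) (extI (prim w) x) x :=
  ((continuous_extI (prim w)).integral_hasStrictDerivAt 0 x).hasDerivAt

lemma deriv_doublePrim (w : L2) : deriv (doublePrim w) = extI (prim w) :=
  funext fun x => (hasDerivAt_doublePrim w x).deriv

lemma doublePrim_one (w : L2) : doublePrim w 1 = inner ℝ oneL2 (toL2 (prim w)) := by
  rw [← prim_oneI, prim_apply, doublePrim]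
  exact (intervalIntegral_congr_ae_μI (coeFn_toL2 _) zero_mem_I one_mem_I).symm

lemma extI_prim_of_notMem_Ioo {w : L2} (hw : w ∈ secondDerivSubmodule) {x : ℝ}
    (hx : x ∉ Ioo (0 : ℝ) 1) : extI (prim w) x = 0 := by
  rcases le_or_gt x 0 with h | h
  · rw [extI, IccExtend_of_le_left _ _ h, prim_apply, intervalIntegral.integral_same]
  · rw [extI, IccExtend_of_right_le _ _ (not_lt.1 fun h' => hx ⟨h, h'⟩)]
    exact (prim_oneI w).trans hw.1

lemma doublePrim_of_notMem_Icc {w : L2} (hw : w ∈ secondDerivSubmodule) {x : ℝ}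
    (hx : x ∉ Icc (0 : ℝ) 1) : doublePrim w x = 0 := by
  have hzero {c : ℝ} (h : Disjoint (uIcc c x) (Ioo 0 1)) :
      ∫ y in c..x, extI (prim w) y = 0 :=
    (intervalIntegral.integral_congr fun y hy =>
      extI_prim_of_notMem_Ioo hw (disjoint_left.1 h hy)).trans intervalIntegral.integral_zero
  rcases lt_or_ge x 0 with h | h
  · refine hzero (disjoint_left.2 fun y hy hy' => ?_)
    rw [uIcc_of_ge h.le] at hy
    exact hy.2.not_gt hy'.1
  · have h1 : 1 < x := not_le.1 fun h' => hx ⟨h, h'⟩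
    have hintegral (c d : ℝ) := (continuous_extI (prim w)).intervalIntegrable (μ := volume) c d
    rw [doublePrim, ← intervalIntegral.integral_add_adjacent_intervals (hintegral 0 1)
      (hintegral 1 x), hzero (disjoint_left.2 fun y hy hy' => ?_), add_zero]
    · exact (doublePrim_one w).trans hw.2
    · rw [uIcc_of_le h1.le] at hy
      exact hy.1.not_gt hy'.2

lemma deriv_deriv_doublePrim (w : L2) : deriv (deriv (doublePrim w)) =ᵐ[μI] w := by
  rw [deriv_doublePrim]
  filter_upwards [ae_hasDerivAt_extI_prim w] with x hx using hx.deriv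

lemma memH02_doublePrim {w : L2} (hw : w ∈ secondDerivSubmodule) : MemH02 (doublePrim w) where
  eq_zero _ hx := doublePrim_of_notMem_Icc hw hx
  differentiable x := (hasDerivAt_doublePrim w x).differentiableAt
  absCont := by
    rw [deriv_doublePrim]
    refine absolutelyContinuousOnInterval_congr
      (absolutelyContinuousOnInterval_primitive (integrable_L2 w)) fun x hx => ?_
    rw [uIcc_of_le zero_le_one] at hx
    exact (extI_prim w hx).symm
  memLp := (Lp.memLp w).ae_eq (deriv_deriv_doublePrim w).symm

/-- The second derivative, as a linear isometry of `H₀²([0,1])` onto its range. -/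
def secondDerivEquiv : H02 ≃ₗᵢ[ℝ] secondDerivSubmodule :=
  LinearIsometryEquiv.ofSurjective
    { toLinearMap :=
        secondDeriv.codRestrict secondDerivSubmodule secondDeriv_mem_secondDerivSubmodule
      norm_map' := fun _ => rfl }
    fun w => ⟨⟨doublePrim w, memH02_doublePrim w.2⟩, Subtype.ext <| Lp.ext <|
      (coeFn_secondDeriv _).trans (deriv_deriv_doublePrim w)⟩

lemma secondDerivEquiv_apply (f : H02) : (secondDerivEquiv f : L2) = secondDeriv f := rfl

/-- The second derivative `H₀²([0,1]) → L²([0,1])` as a continuous linear map. -/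
def secondDerivCLM : H02 →L[ℝ] L2 :=
  secondDerivSubmodule.subtypeL ∘L (secondDerivEquiv : H02 →L[ℝ] secondDerivSubmodule)

instance : CompleteSpace secondDerivSubmodule :=
  ((innerSL ℝ oneL2).isClosed_ker.inter
    (innerSL ℝ oneL2 ∘L toL2 ∘L prim).isClosed_ker).completeSpace_coe

/-- The inverse of the second derivative, extended to `L²([0,1])` by the orthogonal projection onto
the range, so that it is smooth on an open set. -/
def integrateTwice : L2 →L[ℝ] H02 :=
  (secondDerivEquiv.symm : secondDerivSubmodule →L[ℝ] H02) ∘L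
    secondDerivSubmodule.orthogonalProjectionOnto

lemma secondDeriv_integrateTwice {w : L2} (hw : w ∈ secondDerivSubmodule) :
    secondDeriv (integrateTwice w) = w := by
  have hproj : secondDerivSubmodule.orthogonalProjectionOnto w = ⟨w, hw⟩ :=
    Submodule.orthogonalProjectionOnto_mem_subspace_eq_self (⟨w, hw⟩ : secondDerivSubmodule)
  rw [← secondDerivEquiv_apply]
  exact congrArg Subtype.val ((secondDerivEquiv.apply_symm_apply _).trans hproj)

lemma integrateTwice_secondDeriv (f : H02) : integrateTwice (secondDeriv f) = f :=
  secondDeriv_injective (secondDeriv_integrateTwice (secondDeriv_mem_secondDerivSubmodule f))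

/-! ### The coordinate `q = ∂ₓ log ∂ₓφ` -/

lemma hasDerivAt_toMap (f : H02) (x : ℝ) : HasDerivAt (toMap f) (1 + deriv f x) x :=
  (hasDerivAt_id x).add (f.memH02.differentiable x).hasDerivAt

lemma isUnit_one_add_prim_secondDeriv {f : H02} (hf : f ∈ Diff02) :
    IsUnit (1 + prim (secondDeriv f)) := by
  rw [ContinuousMap.isUnit_iff_forall_ne_zero]
  intro x
  rw [ContinuousMap.add_apply, ContinuousMap.one_apply, prim_secondDeriv]
  exact (hf x x.2).ne'

lemma integrateTwice_derivEta_mem_Diff02 {q : L2} (hq : q ∈ Q) :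
    integrateTwice (derivEta q) ∈ Diff02 := fun x hx => by
  have hη := etaC_apply q ⟨x, hx⟩
  rw [etaC_eq_one_add_prim, ContinuousMap.add_apply, ContinuousMap.one_apply,
    ← secondDeriv_integrateTwice (derivEta_mem_secondDerivSubmodule_iff.2 hq),
    prim_secondDeriv] at hη
  rw [hη]
  exact eta_pos q x

lemma coeFn_logDerivCoord {f : H02} (hf : f ∈ Diff02) :
    logDerivCoord f =ᵐ[μI] fun x => deriv (deriv f) x / (1 + deriv f x) := by
  rw [logDerivCoord, dif_pos hf]
  filter_upwards [MemLp.coeFn_toLp (memLp_logDeriv hf), ae_differentiableAt_of_ac f.memH02.absCont,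
    ae_restrict_mem measurableSet_Icc] with x hcoe hdiff hx
  rw [hcoe, funext fun y => (hasDerivAt_toMap f y).deriv]
  exact ((hdiff.hasDerivAt.const_add 1).log (hf x hx).ne').deriv

lemma logDerivCoord_eq_logDerivMap {f : H02} (hf : f ∈ Diff02) :
    logDerivCoord f = logDerivMap (secondDeriv f) := by
  have hmul : mulL2 (1 + prim (secondDeriv f)) (logDerivCoord f) = secondDeriv f := by
    refine Lp.ext ?_
    filter_upwards [coeFn_mulL2 (1 + prim (secondDeriv f)) (logDerivCoord f),
      coeFn_logDerivCoord hf, coeFn_secondDeriv f, ae_restrict_mem measurableSet_Icc]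
      with x hmul hlog hsnd hx
    rw [hmul, hlog, hsnd, extI_of_mem _ hx, ContinuousMap.add_apply, ContinuousMap.one_apply,
      prim_secondDeriv]
    exact mul_div_cancel₀ _ (hf x hx).ne'
  rw [logDerivMap]
  nth_rw 2 [← hmul]
  rw [mulL2_mulL2, Ring.inverse_mul_cancel _ (isUnit_one_add_prim_secondDeriv hf), one_mulL2]

lemma logDerivCoord_mem_Q {f : H02} (hf : f ∈ Diff02) : logDerivCoord f ∈ Q := by
  rw [logDerivCoord_eq_logDerivMap hf]
  exact logDerivMap_mem_Q (isUnit_one_add_prim_secondDeriv hf)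
    (secondDeriv_mem_secondDerivSubmodule f)

lemma derivEta_logDerivCoord {f : H02} (hf : f ∈ Diff02) :
    derivEta (logDerivCoord f) = secondDeriv f := by
  rw [logDerivCoord_eq_logDerivMap hf, derivEta_logDerivMap (isUnit_one_add_prim_secondDeriv hf)]

lemma etaC_logDerivCoord {f : H02} (hf : f ∈ Diff02) :
    etaC (logDerivCoord f) = 1 + prim (secondDeriv f) := by
  rw [etaC_eq_one_add_prim, derivEta_logDerivCoord hf]

lemma eta_logDerivCoord {f : H02} (hf : f ∈ Diff02) {x : ℝ} (hx : x ∈ Icc (0 : ℝ) 1) :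
    eta (logDerivCoord f) x = 1 + deriv f x := by
  rw [← etaC_apply _ ⟨x, hx⟩, etaC_logDerivCoord hf, ContinuousMap.add_apply,
    ContinuousMap.one_apply, prim_secondDeriv]

lemma phi_logDerivCoord {f : H02} (hf : f ∈ Diff02) {x : ℝ} (hx : x ∈ Icc (0 : ℝ) 1) :
    phi (logDerivCoord f) x = toMap f x := by
  rw [← phiC_apply _ ⟨x, hx⟩, phiC, etaC_logDerivCoord hf, map_add, map_add,
    ContinuousMap.add_apply, prim_toL2_prim_secondDeriv, toL2_one, prim_apply,
    intervalIntegral_congr_ae_μI coeFn_oneL2 zero_mem_I hx, intervalIntegral.integral_const,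
    smul_eq_mul, mul_one, sub_zero, toMap]

/-! ### The right-invariant metric -/

lemma one_add_deriv_pos {f : H02} (hf : f ∈ Diff02) (x : ℝ) : 0 < 1 + deriv f x := by
  by_cases hx : x ∈ Icc (0 : ℝ) 1
  · exact hf x hx
  · rw [f.memH02.deriv_of_notMem hx, add_zero]
    exact one_pos

lemma strictMono_toMap {f : H02} (hf : f ∈ Diff02) : StrictMono (toMap f) :=
  strictMono_of_deriv_pos fun x => by
    rw [(hasDerivAt_toMap f x).deriv]
    exact one_add_deriv_pos hf x

lemma surjective_toMap (f : H02) : Function.Surjective (toMap f) := by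
  intro y
  by_cases hy : y ∈ Icc (0 : ℝ) 1
  · have hcont : ContinuousOn (toMap f) (Icc 0 1) := fun x _ =>
      (hasDerivAt_toMap f x).continuousAt.continuousWithinAt
    have hivt := intermediate_value_Icc zero_le_one hcont
    rw [toMap, toMap, f.memH02.apply_zero, f.memH02.apply_one, add_zero, add_zero] at hivt
    obtain ⟨x, -, hx⟩ := hivt hy
    exact ⟨x, hx⟩
  · exact ⟨y, by rw [toMap, f.memH02.eq_zero y hy, add_zero]⟩

lemma invFun_toMap_toMap {f : H02} (hf : f ∈ Diff02) (x : ℝ) :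
    Function.invFun (toMap f) (toMap f x) = x :=
  Function.leftInverse_invFun (strictMono_toMap hf).injective x

lemma continuous_invFun_toMap {f : H02} (hf : f ∈ Diff02) :
    Continuous (Function.invFun (toMap f)) := by
  have hsymm : Function.invFun (toMap f) =
      ((strictMono_toMap hf).orderIsoOfSurjective (toMap f) (surjective_toMap f)).symm := by
    funext y
    obtain ⟨x, rfl⟩ := surjective_toMap f y
    rw [invFun_toMap_toMap hf, StrictMono.orderIsoOfSurjective_symm_apply_self]
  rw [hsymm]
  exact OrderIso.continuous _

lemma hasDerivAt_invFun_toMap {f : H02} (hf : f ∈ Diff02) (x : ℝ) :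
    HasDerivAt (Function.invFun (toMap f)) (1 + deriv f x)⁻¹ (toMap f x) := by
  refine HasDerivAt.of_local_left_inverse (f := toMap f)
    (continuous_invFun_toMap hf).continuousAt ?_ (one_add_deriv_pos hf x).ne'
    (Eventually.of_forall (Function.rightInverse_invFun (surjective_toMap f)))
  rw [invFun_toMap_toMap hf]
  exact hasDerivAt_toMap f x

lemma deriv_comp_invFun_toMap {f : H02} (hf : f ∈ Diff02) {g : ℝ → ℝ} {g' x : ℝ}
    (hg : HasDerivAt g g' x) :
    deriv (fun y => g (Function.invFun (toMap f) y)) (toMap f x) = g' / (1 + deriv f x) := by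
  rw [← invFun_toMap_toMap hf x] at hg
  rw [div_eq_mul_inv]
  exact (hg.comp (toMap f x) (hasDerivAt_invFun_toMap hf x)).deriv

/-- The tangent map at `φ = Id + f` of the change of variable `φ ↦ q = ∂ₓ log ∂ₓφ`. -/
def logDerivTangent (f X : H02) : L2 := fderiv ℝ logDerivMap (secondDeriv f) (secondDeriv X)

lemma fderiv_derivEta_logDerivCoord {f : H02} (hf : f ∈ Diff02) (X : H02) :
    fderiv ℝ derivEta (logDerivCoord f) (logDerivTangent f X) = secondDeriv X := by
  have hu := isUnit_one_add_prim_secondDeriv hf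
  have hleft : derivEta ∘ logDerivMap =ᶠ[𝓝 (secondDeriv f)] id := by
    filter_upwards [isOpen_setOf_isUnit_one_add_prim.mem_nhds hu] with w hw
    exact derivEta_logDerivMap hw
  have hcomp := ((hasFDerivAt_derivEta _).comp _ (hasFDerivAt_logDerivMap hu)).unique
    ((hasFDerivAt_id _).congr_of_eventuallyEq hleft)
  rw [logDerivCoord_eq_logDerivMap hf]
  exact congrArg (· (secondDeriv X)) hcomp

lemma prim_secondDeriv_eq_etaC_mul {f : H02} (hf : f ∈ Diff02) (X : H02) :
    prim (secondDeriv X) = etaC (logDerivCoord f) * prim (logDerivTangent f X) := by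
  rw [← fderiv_derivEta_logDerivCoord hf, prim_fderiv_derivEta]

lemma deriv_div_one_add_deriv {f : H02} (hf : f ∈ Diff02) (X : H02) {x : ℝ}
    (hx : x ∈ Icc (0 : ℝ) 1) :
    deriv X x / (1 + deriv f x) = extI (prim (logDerivTangent f X)) x := by
  rw [← prim_secondDeriv X ⟨x, hx⟩, prim_secondDeriv_eq_etaC_mul hf, ContinuousMap.mul_apply,
    etaC_apply, eta_logDerivCoord hf hx, mul_div_cancel_left₀ _ (hf x hx).ne', extI_of_mem _ hx]

lemma deriv_comp_invFun_toMap_eventuallyEq {f : H02} (hf : f ∈ Diff02) (X : H02) {x : ℝ}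
    (hx : x ∈ Ioo (0 : ℝ) 1) :
    deriv (fun y => X (Function.invFun (toMap f) y)) =ᶠ[𝓝 (toMap f x)]
      fun y => extI (prim (logDerivTangent f X)) (Function.invFun (toMap f) y) := by
  have hmem : ∀ᶠ y in 𝓝 (toMap f x), Function.invFun (toMap f) y ∈ Icc (0 : ℝ) 1 := by
    refine (continuous_invFun_toMap hf).continuousAt.eventually ?_
    rw [invFun_toMap_toMap hf]
    exact Icc_mem_nhds hx.1 hx.2
  filter_upwards [hmem] with y hy
  obtain ⟨z, rfl⟩ := surjective_toMap f y
  rw [invFun_toMap_toMap hf] at hy ⊢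
  rw [deriv_comp_invFun_toMap hf (X.memH02.differentiable z).hasDerivAt,
    deriv_div_one_add_deriv hf X hy]

lemma ae_deriv_deriv_comp_invFun_toMap {f : H02} (hf : f ∈ Diff02) (X : H02) :
    ∀ᵐ x ∂μI, deriv (deriv fun y => X (Function.invFun (toMap f) y)) (toMap f x) =
      logDerivTangent f X x / eta (logDerivCoord f) x := by
  filter_upwards [ae_mem_Ioo, ae_hasDerivAt_extI_prim (logDerivTangent f X)] with x hx hprim
  rw [(deriv_comp_invFun_toMap_eventuallyEq hf X hx).deriv_eq, deriv_comp_invFun_toMap hf hprim,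
    eta_logDerivCoord hf (Ioo_subset_Icc_self hx)]

theorem metricQ_logDerivTangent {f : H02} (hf : f ∈ Diff02) (X Y : H02) :
    metricQ (logDerivCoord f) (logDerivTangent f X) (logDerivTangent f Y) =
      rightInvMetric f X Y := by
  rw [rightInvMetric, innerH02, integral_eq_integral_eta_mul_comp_phi (logDerivCoord_mem_Q hf),
    metricQ]
  refine intervalIntegral_congr_ae_μI ?_ zero_mem_I one_mem_I
  filter_upwards [ae_deriv_deriv_comp_invFun_toMap hf X, ae_deriv_deriv_comp_invFun_toMap hf Y,
    ae_restrict_mem measurableSet_Icc] with x hX hY hx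
  have hη := (eta_pos (logDerivCoord f) x).ne'
  rw [phi_logDerivCoord hf hx, hX, hY]
  field_simp

/-! ### Geodesics of the group of diffeomorphisms -/

section GeodesicsOfDiff02

variable {a b : ℝ} {γ : ℝ → H02}

lemma contDiffAt_logDerivMap_secondDeriv {n : WithTop ℕ∞} {f : H02} (hf : f ∈ Diff02) :
    ContDiffAt ℝ n (fun f : H02 => logDerivMap (secondDeriv f)) f :=
  (contDiffAt_logDerivMap (isUnit_one_add_prim_secondDeriv hf)).comp f
    secondDerivCLM.contDiff.contDiffAt

lemma fderiv_logDerivMap_secondDeriv {f : H02} (hf : f ∈ Diff02) (X : H02) :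
    fderiv ℝ (fun f : H02 => logDerivMap (secondDeriv f)) f X = logDerivTangent f X :=
  congrArg (· X) ((hasFDerivAt_logDerivMap (isUnit_one_add_prim_secondDeriv hf)).comp f
    secondDerivCLM.hasFDerivAt).fderiv

theorem isGeodesic_Diff02_iff_isGeodesic_Q (hab : a < b) (hγ : MapsTo γ (Icc a b) Diff02) :
    IsGeodesic Diff02 rightInvMetric a b γ ↔
      IsGeodesic Q metricQ a b fun t => logDerivMap (secondDeriv (γ t)) := by
  have hΦ (f) (hf : f ∈ Diff02) :
      ContDiffAt ℝ 2 (fun f : H02 => logDerivMap (secondDeriv f)) f :=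
    contDiffAt_logDerivMap_secondDeriv hf
  have hΨ (q : L2) (_ : q ∈ Q) : ContDiffAt ℝ 2 (fun q => integrateTwice (derivEta q)) q :=
    (integrateTwice.contDiff.comp contDiff_derivEta).contDiffAt
  have hmaps : MapsTo (fun f : H02 => logDerivMap (secondDeriv f)) Diff02 Q := fun f hf =>
    logDerivMap_mem_Q (isUnit_one_add_prim_secondDeriv hf) (secondDeriv_mem_secondDerivSubmodule f)
  have hleft : LeftInvOn (fun q => integrateTwice (derivEta q))
      (fun f : H02 => logDerivMap (secondDeriv f)) Diff02 := fun f hf => by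
    simp only [derivEta_logDerivMap (isUnit_one_add_prim_secondDeriv hf),
      integrateTwice_secondDeriv]
  have hright : LeftInvOn (fun f : H02 => logDerivMap (secondDeriv f))
      (fun q => integrateTwice (derivEta q)) Q := fun q hq => by
    simp only [secondDeriv_integrateTwice (derivEta_mem_secondDerivSubmodule_iff.2 hq),
      logDerivMap_derivEta]
  have hG (f) (hf : f ∈ Diff02) (X : H02) : metricQ (logDerivMap (secondDeriv f))
      (fderiv ℝ (fun f : H02 => logDerivMap (secondDeriv f)) f X)
      (fderiv ℝ (fun f : H02 => logDerivMap (secondDeriv f)) f X) = rightInvMetric f X X := by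
    rw [fderiv_logDerivMap_secondDeriv hf, ← logDerivCoord_eq_logDerivMap hf,
      metricQ_logDerivTangent hf]
  exact ⟨IsGeodesic.comp hΦ hΨ hmaps (fun q => integrateTwice_derivEta_mem_Diff02) hleft hright hG
    hab, IsGeodesic.of_comp hΦ hΨ hmaps hleft hG hab hγ⟩

lemma IsHamiltonianSolution.congr {q q' p : ℝ → L2} (h : IsHamiltonianSolution a b q p)
    (hqq' : EqOn q q' (Icc a b)) : IsHamiltonianSolution a b q' p := by
  intro t ht
  obtain ⟨hcot, X, hfield, hq, hp⟩ := h t ht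
  rw [hqq' ht] at hcot hfield
  exact ⟨hcot, X, hfield, hq.congr hqq'.symm (hqq' ht).symm, hp⟩

theorem isGeodesic_Diff02_iff (hab : a < b) (hγ : MapsTo γ (Icc a b) Diff02) :
    IsGeodesic Diff02 rightInvMetric a b γ ↔
      ∃ p : ℝ → L2, IsHamiltonianSolution a b (fun t => logDerivCoord (γ t)) p := by
  rw [isGeodesic_Diff02_iff_isGeodesic_Q hab hγ, isGeodesic_Q_iff hab]
  have hcoord : EqOn (fun t => logDerivMap (secondDeriv (γ t))) (fun t => logDerivCoord (γ t))
      (Icc a b) := fun t ht => (logDerivCoord_eq_logDerivMap (hγ ht)).symm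
  exact exists_congr fun p => ⟨fun hp => hp.congr hcoord, fun hp => hp.congr hcoord.symm⟩

end GeodesicsOfDiff02

end DiffGeodesics

end

open DiffGeodesics in
theorem mainTheorem6 :
    -- the change of variable
    (∀ f ∈ Diff02, logDerivCoord f ∈ Q ∧
      ∀ x ∈ Icc (0 : ℝ) 1, phi (logDerivCoord f) x = toMap f x) ∧
    -- geodesics of the right-invariant metric on the group of diffeomorphisms
    (∀ a b : ℝ, a < b → ∀ γ : ℝ → H02, (∀ t ∈ Icc a b, γ t ∈ Diff02) →
      (IsGeodesic Diff02 rightInvMetric a b γ ↔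
        ∃ p : ℝ → L2, IsHamiltonianSolution a b (fun t => logDerivCoord (γ t)) p)) ∧
    -- geodesics of the submanifold of `L²([0,1])`
    (∀ a b : ℝ, a < b → ∀ q : ℝ → L2,
      (IsGeodesic Q metricQ a b q ↔ ∃ p : ℝ → L2, IsHamiltonianSolution a b q p)) ∧
    -- the system is the Hamiltonian system of the kinetic energy on the cotangent bundle
    (∀ q p : L2, (q, p) ∈ cotangentQ →
      ∃ dH : (L2 × L2) →L[ℝ] ℝ, HasFDerivAt hamiltonian dH (q, p) ∧
        ∃ X ∈ tangentConeAt ℝ cotangentQ (q, p), IsFieldAt q p X ∧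
          ∀ V ∈ tangentConeAt ℝ cotangentQ (q, p),
            (∀ W ∈ tangentConeAt ℝ cotangentQ (q, p), symplecticForm V W = dH W) ↔ V = X) := by
  refine ⟨fun f hf => ⟨logDerivCoord_mem_Q hf, fun x hx => phi_logDerivCoord hf hx⟩,
    fun a b hab γ hγ => isGeodesic_Diff02_iff hab hγ, fun a b hab q => isGeodesic_Q_iff hab q,
    fun q p h => hamiltonian_vectorField h⟩
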